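/- **Conventions.** Manifolds are connected, Hausdorff and paracompact. A *$CR$ manifold of type $(n,k)$* is a smooth manifold $M$ of real dimension $2n+k$ with a smooth subbundle $HM\subset TM$ of rank $2n$ and a smooth complex structure $J$ on the fibres of $HM$ such that the sections of $T^{0,1}M=\{X+\sqrt{-1}\,JX : X\in HM\}$ are closed under the Lie bracket. A smooth complex valued function $u$ on an open subset of $M$ is a *$CR$ function* if it is annihilated by $T^{0,1}M$; $\mathcal{CR}_{M,a}$ denotes the ring of germs at $a\in M$ of smooth $CR$ functions, and $\mathcal O_{X,p}$ the ring of germs at $p$ of holomorphic functions on a complex manifold $X$. An *$E$-pair* $(M,X)$ consists of a $CR$ manifold $M$ of type $(n,k)$ and a complex manifold $X$ of complex dimension $n+k$ such that 1. $M$ is a generic $CR$ submanifold of $X$, i.e. there is a smooth embedding $\phi:M\to X$ with $\phi_*(Jv)=\sqrt{-1}\,\phi_*(v)$ for all $v\in HM$ and $\phi_*(H_aM)=\phi_*(T_aM)\cap \sqrt{-1}\,\phi_*(T_aM)$ for all $a\in M$; and 2. for each $a\in M$ the restriction map $g\mapsto g\circ\phi$ is an isomorphism $\mathcal O_{X,\phi(a)}\to\mathcal{CR}_{M,a}$.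 $M$ *has property $E$* if there is an $E$-pair $(M,X)$. The same definition applies to an open subset of $M$ (connected or not) with the induced $CR$ structure. **Theorem.** Let $M$ be a $CR$ manifold of type $(n,k)$. Then $M$ has property $E$ if and only if each $a\in M$ has an open neighbourhood $\omega_a$ in $M$ such that $\omega_a$ has property $E$. -/

import Mathlib

open scoped Manifold ContDiff Topology
open Set Filter TopologicalSpace

universe u

noncomputable section

/-- The family of tangent vectors `V` is a `C^∞` vector field on the set `U`. -/
def SmoothFieldOn {d : ℕ} {M : Type u} [TopologicalSpace M]
    [ChartedSpace (EuclideanSpace ℝ (Fin d)) M] [IsManifold (𝓡 d) ∞ M]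
    (V : ∀ x : M, TangentSpace (𝓡 d) x) (U : Set M) : Prop :=
  ContMDiffOn (𝓡 d) (𝓡 d).tangent ∞ (fun x => (⟨x, V x⟩ : TangentBundle (𝓡 d) M)) U

/-- An abstract `CR` structure of type `(n, k)` on a smooth manifold `M` of dimension `2 n + k`:
a smooth subbundle `H` of `TM` of rank `2 n`, a smooth complex structure `J` on the fibres of `H`,
and the formal integrability condition for `T^{0,1} M = {X + i J X | X ∈ H}`. -/
structure CRStructure (n k : ℕ) (M : Type u) [TopologicalSpace M]
    [ChartedSpace (EuclideanSpace ℝ (Fin (2 * n + k))) M]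
    [IsManifold (𝓡 (2 * n + k)) ∞ M] where
  /-- The holomorphic tangent space. -/
  H : ∀ x : M, Submodule ℝ (TangentSpace (𝓡 (2 * n + k)) x)
  /-- The partial complex structure. -/
  J : ∀ x : M, H x →ₗ[ℝ] H x
  /-- `H` is a smooth subbundle of rank `2 n`: it has smooth local frames of length `2 n`. -/
  exists_frame : ∀ x₀ : M, ∃ U : Set M, IsOpen U ∧ x₀ ∈ U ∧
    ∃ e : Fin (2 * n) → ∀ x : M, TangentSpace (𝓡 (2 * n + k)) x,
      (∀ i, SmoothFieldOn (e i) U) ∧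
      ∀ x ∈ U, LinearIndependent ℝ (fun i => e i x) ∧
        Submodule.span ℝ (range fun i => e i x) = H x
  J_J : ∀ (x : M) (v : H x), J x (J x v) = -v
  /-- `J` is smooth: it maps smooth local sections of `H` to smooth local sections of `H`. -/
  smooth_J : ∀ (U : Set M), IsOpen U → ∀ V : ∀ x : M, H x,
    SmoothFieldOn (fun x => (V x : TangentSpace (𝓡 (2 * n + k)) x)) U →
    SmoothFieldOn (fun x => (J x (V x) : TangentSpace (𝓡 (2 * n + k)) x)) U
  /-- Formal integrability: for smooth sections `V`, `W` of `H` over an open set, the bracket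
  `[V + i J V, W + i J W] = ([V, W] - [J V, J W]) + i ([J V, W] + [V, J W])`
  is again of the form `Z + i J Z` with `Z` in `H`. -/
  integrable : ∀ (U : Set M), IsOpen U → ∀ V W : ∀ x : M, H x,
    SmoothFieldOn (fun x => (V x : TangentSpace (𝓡 (2 * n + k)) x)) U →
    SmoothFieldOn (fun x => (W x : TangentSpace (𝓡 (2 * n + k)) x)) U →
    ∀ x ∈ U, ∃ Z : H x,
      (Z : TangentSpace (𝓡 (2 * n + k)) x) =
        VectorField.mlieBracket (𝓡 (2 * n + k)) (fun y => (V y).1)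
          (fun y => (W y).1) x
        - VectorField.mlieBracket (𝓡 (2 * n + k)) (fun y => (J y (V y)).1)
          (fun y => (J y (W y)).1) x ∧
      (J x Z : TangentSpace (𝓡 (2 * n + k)) x) =
        VectorField.mlieBracket (𝓡 (2 * n + k)) (fun y => (J y (V y)).1)
          (fun y => (W y).1) x
        + VectorField.mlieBracket (𝓡 (2 * n + k)) (fun y => (V y).1)
          (fun y => (J y (W y)).1) x

/-- The derivative `du(v)` of a complex valued function along a real tangent vector. -/
def dirDeriv {d : ℕ} {M : Type u} [TopologicalSpace M]
    [ChartedSpace (EuclideanSpace ℝ (Fin d)) M]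
    (u : M → ℂ) (x : M) (v : TangentSpace (𝓡 d) x) : ℂ :=
  mfderiv (𝓡 d) 𝓘(ℝ, ℂ) u x v

/-- Multiplication by `i` on the tangent space of a complex manifold `X`, regarded as a real
manifold with the same charts. -/
def complexJ {N : ℕ} {X : Type u} [TopologicalSpace X]
    [ChartedSpace (EuclideanSpace ℂ (Fin N)) X] (p : X) :
    TangentSpace 𝓘(ℝ, EuclideanSpace ℂ (Fin N)) p →ₗ[ℝ]
      TangentSpace 𝓘(ℝ, EuclideanSpace ℂ (Fin N)) p :=
  (show EuclideanSpace ℂ (Fin N) →ₗ[ℝ] EuclideanSpace ℂ (Fin N) from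
    (LinearMap.lsmul ℂ (EuclideanSpace ℂ (Fin N)) Complex.I).restrictScalars ℝ)

/-- Germs at `p` of holomorphic functions on a complex manifold `X`: the stalk `𝒪_{X,p}`. -/
def holGerms {N : ℕ} {X : Type u} [TopologicalSpace X]
    [ChartedSpace (EuclideanSpace ℂ (Fin N)) X] (p : X) : Set (Germ (𝓝 p) ℂ) :=
  {g | ∃ W : Set X, IsOpen W ∧ p ∈ W ∧ ∃ f : X → ℂ,
    MDifferentiableOn 𝓘(ℂ, EuclideanSpace ℂ (Fin N)) 𝓘(ℂ, ℂ) f W ∧ g = (f : Germ (𝓝 p) ℂ)}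

namespace CRStructure

variable {n k : ℕ} {M : Type u} [TopologicalSpace M]
  [ChartedSpace (EuclideanSpace ℝ (Fin (2 * n + k))) M] [IsManifold (𝓡 (2 * n + k)) ∞ M]

/-- `u` is a smooth `CR` function on the open set `U`: it is `C^∞` there and is annihilated by
all vectors `v + i J v`, `v ∈ H`, of `T^{0,1} M`. -/
def IsCRFunctionOn (S : CRStructure n k M) (u : M → ℂ) (U : Set M) : Prop :=
  ContMDiffOn (𝓡 (2 * n + k)) 𝓘(ℝ, ℂ) ∞ u U ∧
  ∀ x ∈ U, ∀ v : S.H x, dirDeriv u x v.1 + Complex.I * dirDeriv u x (S.J x v).1 = 0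

/-- Germs at `a` of smooth `CR` functions: the stalk `𝒞ℛ_{M,a}`. -/
def crGerms (S : CRStructure n k M) (a : M) : Set (Germ (𝓝 a) ℂ) :=
  {g | ∃ U : Set M, IsOpen U ∧ a ∈ U ∧ ∃ u : M → ℂ,
    S.IsCRFunctionOn u U ∧ g = (u : Germ (𝓝 a) ℂ)}

/-- The restriction of `φ` to the open set `U` of `M`, with the induced `CR` structure, is a
generic `CR` embedding of `U` in the complex manifold `X` of dimension `n + k`. Values of `φ`
outside `U` are irrelevant. -/
structure IsGenericCREmbeddingOn (S : CRStructure n k M) (U : Opens M)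
    {X : Type u} [TopologicalSpace X] [ChartedSpace (EuclideanSpace ℂ (Fin (n + k))) X]
    (φ : M → X) : Prop where
  smooth : ContMDiffOn (𝓡 (2 * n + k)) 𝓘(ℝ, EuclideanSpace ℂ (Fin (n + k))) ∞ φ U
  isEmbedding : Topology.IsEmbedding ((U : Set M).domRestrict φ)
  immersion : ∀ x ∈ U, Function.Injective
    (mfderiv (𝓡 (2 * n + k)) 𝓘(ℝ, EuclideanSpace ℂ (Fin (n + k))) φ x)
  /-- `φ` is a `CR` map: `φ_* (J v) = i φ_* v` for `v ∈ H`. -/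
  isCR : ∀ x ∈ U, ∀ v : S.H x,
    mfderiv (𝓡 (2 * n + k)) 𝓘(ℝ, EuclideanSpace ℂ (Fin (n + k))) φ x (S.J x v) =
      complexJ (φ x) (mfderiv (𝓡 (2 * n + k)) 𝓘(ℝ, EuclideanSpace ℂ (Fin (n + k))) φ x v)
  /-- `φ_* (H_x M) = φ_* (T_x M) ∩ i φ_* (T_x M)`. -/
  map_H : ∀ x ∈ U,
    (S.H x).map
        (mfderiv (𝓡 (2 * n + k)) 𝓘(ℝ, EuclideanSpace ℂ (Fin (n + k))) φ x).toLinearMap =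
      LinearMap.range
        (mfderiv (𝓡 (2 * n + k)) 𝓘(ℝ, EuclideanSpace ℂ (Fin (n + k))) φ x).toLinearMap ⊓
      (LinearMap.range
        (mfderiv (𝓡 (2 * n + k)) 𝓘(ℝ, EuclideanSpace ℂ (Fin (n + k))) φ x).toLinearMap).map
          (complexJ (φ x))

theorem IsGenericCREmbeddingOn.tendsto {S : CRStructure n k M} {U : Opens M}
    {X : Type u} [TopologicalSpace X] [ChartedSpace (EuclideanSpace ℂ (Fin (n + k))) X]
    {φ : M → X} (h : S.IsGenericCREmbeddingOn U φ) {a : M} (ha : a ∈ U) :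
    Tendsto φ (𝓝 a) (𝓝 (φ a)) :=
  (h.smooth.contMDiffAt (U.isOpen.mem_nhds ha)).continuousAt

/-- `(U, X)` is an `E`-pair via `φ`: `φ` is a generic `CR` embedding of `U` in `X`, and at every
`a ∈ U` the restriction homomorphism `g ↦ g ∘ φ` is a bijection of the ring `𝒪_{X, φ a}` of
holomorphic germs onto the ring `𝒞ℛ_{M, a}` of smooth `CR` germs. -/
structure IsEPairOn (S : CRStructure n k M) (U : Opens M)
    {X : Type u} [TopologicalSpace X] [ChartedSpace (EuclideanSpace ℂ (Fin (n + k))) X]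
    (φ : M → X) : Prop where
  isEmbeddingOn : S.IsGenericCREmbeddingOn U φ
  bijOn_germs : ∀ (a : M) (ha : a ∈ U),
    BijOn (fun g : Germ (𝓝 (φ a)) ℂ => g.compTendsto φ (isEmbeddingOn.tendsto ha))
      (holGerms (N := n + k) (φ a)) (S.crGerms a)

/-- The open subset `U` of `M`, with the induced `CR` structure, has property `E`: there is an
`E`-pair `(U, X)`. Complex manifolds are Hausdorff, paracompact and connected. -/
def HasPropertyEOn (S : CRStructure n k M) (U : Opens M) : Prop :=
  ∃ (X : Type u) (_ : TopologicalSpace X) (_ : ChartedSpace (EuclideanSpace ℂ (Fin (n + k))) X)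
    (_ : IsManifold 𝓘(ℂ, EuclideanSpace ℂ (Fin (n + k))) ω X)
    (_ : T2Space X) (_ : ParacompactSpace X) (_ : ConnectedSpace X) (φ : M → X),
    S.IsEPairOn U φ

/-- The `CR` manifold `M` has property `E`. -/
def HasPropertyE (S : CRStructure n k M) : Prop := S.HasPropertyEOn ⊤

end CRStructure

end

/-!
The nontrivial direction is a gluing theorem. Composing with charts, every point of `M` has a
neighbourhood which is part of an `E`-pair with target `ℂ ^ (n + k)`. If `φ` and `ψ` are two such
embeddings, the components of `ψ` are `CR` functions, so near each point they extend to holomorphic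
functions along `φ`; this gives a germ of a holomorphic map `F` with `F ∘ φ = ψ`
(`CRStructure.IsEPairAt.exists_isTransitionAt`). Since the extension is unique, these germs compose
as they should, and in particular they are germs of biholomorphisms. They are analytic by Osgood's
lemma (`analyticAt_euclidean_of_eventually_differentiableAt`).

The difficulty is to glue neighbourhoods of the pieces of `M` along these germs to a *Hausdorff*
manifold. Choose a countable locally finite covering of `M` by compact sets `A i` with embeddings
`φ i`. The transition germs along `A i ∩ A j` are represented by a compact relation `C i j` in
`ℂ ^ (n + k) × ℂ ^ (n + k)`, a finite union of graphs over closed balls, which meets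
`φ i (A i) × φ j (A j)` only in the pairs `(φ i x, φ j x)`
(`AnalyticThickening.exists_relation`). Symmetry, transitivity and the property of being locally the
graph of an analytic map hold for these relations near the points of the `φ i (A i)`. By compactness
and local finiteness they hold on sufficiently small neighbourhoods of these sets
(`AnalyticThickening.exists_radius`). The quotient of the disjoint union of these neighbourhoods is
then a complex manifold, and it is Hausdorff because the relations are closed and the quotient map
is open (`AnalyticGluing.Glued`). It contains `M` as a closed subset, and near each point of `M` it
looks like one of the given local `E`-pairs; the conditions on germs in the definition of an
`E`-pair are invariant under biholomorphic maps
(`CRStructure.IsEPairAt.openPartialHomeomorph_comp`).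
-/

/-! ### Osgood's lemma -/

/-- Cauchy's integral formula on a polydisc. -/
theorem torusIntegral_prod_sub_inv_mul {N : ℕ} (f : (Fin N → ℂ) → ℂ) (c z : Fin N → ℂ) {R : ℝ}
    (hR : 0 < R) (hz : z ∈ Metric.ball c R)
    (hf : ∀ w ∈ Metric.closedBall c R, DifferentiableAt ℂ f w) :
    (∯ w in T(c, fun _ => R), (∏ l, (w l - z l)⁻¹) * f w) =
      (2 * Real.pi * Complex.I) ^ N * f z := by
  induction N with
  | zero => simp [torusIntegral_dim0, Subsingleton.elim z c]
  | succ N ih =>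
    have hzl : ∀ l, z l ∈ Metric.ball (c l) R := fun l =>
      Metric.mem_ball.2 (((dist_pi_lt_iff hR).1 (Metric.mem_ball.1 hz)) l)
    have hint : TorusIntegrable (fun w => (∏ l, (w l - z l)⁻¹) * f w) c (fun _ => R) := by
      refine ContinuousOn.integrableOn_compact isCompact_Icc (Continuous.continuousOn ?_)
      have hmap : Continuous (torusMap c fun _ => R) := by unfold torusMap; fun_prop
      refine Continuous.mul (continuous_finsetProd _ fun l _ => ?_) ?_
      · refine Continuous.inv₀ (by fun_prop) fun θ h => ?_
        have h1 := hzl l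
        rw [← sub_eq_zero.1 h, Metric.mem_ball, dist_eq_norm] at h1
        simp [torusMap, Complex.norm_exp_ofReal_mul_I, abs_of_pos hR] at h1
      · refine continuous_iff_continuousAt.2 fun θ =>
          ((hf _ ?_).continuousAt).comp hmap.continuousAt
        refine Metric.mem_closedBall.2 ((dist_pi_le_iff hR.le).2 fun l => ?_)
        simp [torusMap, dist_eq_norm, Complex.norm_exp_ofReal_mul_I, abs_of_pos hR]
    have hcons : ∀ x ∈ Metric.closedBall (c 0) R,
        ∀ w ∈ Metric.closedBall (c ∘ Fin.succ) R,
        (Fin.cons x w : Fin (N + 1) → ℂ) ∈ Metric.closedBall c R := fun x hx w hw => by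
      refine Metric.mem_closedBall.2 ((dist_pi_le_iff hR.le).2 fun l => ?_)
      refine Fin.cases ?_ (fun l => ?_) l
      · simpa using hx
      · simpa using (dist_pi_le_iff hR.le).1 (Metric.mem_closedBall.1 hw) l
    have hz' : z ∘ Fin.succ ∈ Metric.ball (c ∘ Fin.succ) R :=
      Metric.mem_ball.2 ((dist_pi_lt_iff hR).2 fun l => hzl l.succ)
    have hdc : Differentiable ℂ (fun p : ℂ × (Fin N → ℂ) =>
        (Fin.cons p.1 p.2 : Fin (N + 1) → ℂ)) := by
      rw [differentiable_pi]
      refine Fin.cases ?_ fun l => ?_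
      · simp only [Fin.cons_zero]
        fun_prop
      · simp only [Fin.cons_succ]
        fun_prop
    have hdc₁ : ∀ w : Fin N → ℂ, Differentiable ℂ
        (fun x : ℂ => (Fin.cons x w : Fin (N + 1) → ℂ)) := fun w =>
      hdc.comp (by fun_prop : Differentiable ℂ fun x : ℂ => (x, w))
    have hdc₂ : ∀ x : ℂ, Differentiable ℂ
        (fun w : Fin N → ℂ => (Fin.cons x w : Fin (N + 1) → ℂ)) := fun x =>
      hdc.comp (by fun_prop : Differentiable ℂ fun w : Fin N → ℂ => (x, w))
    rw [torusIntegral_succ hint]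
    have hstep : ∀ x ∈ Metric.sphere (c 0) R,
        (∯ y in T(c ∘ Fin.succ, (fun _ => R) ∘ Fin.succ),
          (∏ l, ((Fin.cons x y : Fin (N + 1) → ℂ) l - z l)⁻¹) * f (Fin.cons x y)) =
        (x - z 0)⁻¹ • ((2 * Real.pi * Complex.I) ^ N * f (Fin.cons x (z ∘ Fin.succ))) := by
      intro x hx
      have hx' := Metric.sphere_subset_closedBall hx
      rw [← ih (fun y => f (Fin.cons x y)) (c ∘ Fin.succ) (z ∘ Fin.succ) hz', smul_eq_mul,
        ← torusIntegral_const_mul]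
      · simp only [Fin.prod_univ_succ, Fin.cons_zero, Fin.cons_succ, mul_assoc, Function.comp_def]
      · intro w hw
        exact (hf _ (hcons x hx' w hw)).comp w (hdc₂ x w)
    rw [circleIntegral.integral_congr hR.le hstep]
    rw [DiffContOnCl.circleIntegral_sub_inv_smul (c := c 0) (R := R) (w := z 0)
      (f := fun x => (2 * Real.pi * Complex.I) ^ N * f (Fin.cons x (z ∘ Fin.succ))) ?_ (hzl 0)]
    · have : (Fin.cons (z 0) (z ∘ Fin.succ) : Fin (N + 1) → ℂ) = z := Fin.cons_self_tail z
      simp only [smul_eq_mul, this]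
      ring
    · refine DifferentiableOn.diffContOnCl fun x hx => DifferentiableAt.differentiableWithinAt ?_
      rw [closure_ball _ hR.ne'] at hx
      refine DifferentiableAt.const_mul ?_ _
      exact (hf _ (hcons x hx _ (Metric.ball_subset_closedBall hz'))).comp x (hdc₁ _ x)

open MeasureTheory in
/-- Osgood's lemma for scalar functions on `ℂ ^ N`. By Cauchy's formula on the torus parametrised
by the cube `K`, the function is a continuous linear functional of `∏ l, (w l - z l)⁻¹ * f`, an
element of the Banach algebra `C(K, ℂ)` which depends analytically on `z`, since inversion is
analytic in a Banach algebra. -/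
theorem analyticAt_pi_of_eventually_differentiableAt {N : ℕ} {f : (Fin N → ℂ) → ℂ}
    {c : Fin N → ℂ} (hf : ∀ᶠ w in 𝓝 c, DifferentiableAt ℂ f w) : AnalyticAt ℂ f c := by
  obtain ⟨R, hR, hball⟩ := Metric.nhds_basis_closedBall.mem_iff.1 hf
  let K : Set (Fin N → ℝ) := Icc 0 fun _ => 2 * Real.pi
  have : CompactSpace K := isCompact_iff_compactSpace.1 isCompact_Icc
  have hmap : Continuous (torusMap c fun _ => R) := by unfold torusMap; fun_prop
  have hmem : ∀ θ, torusMap c (fun _ => R) θ ∈ Metric.closedBall c R := fun θ => by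
    refine Metric.mem_closedBall.2 ((dist_pi_le_iff hR.le).2 fun l => ?_)
    simp [torusMap, dist_eq_norm, Complex.norm_exp_ofReal_mul_I, abs_of_pos hR]
  let W : Fin N → C(K, ℂ) := fun l => ⟨fun θ => torusMap c (fun _ => R) θ l, by fun_prop⟩
  let D : C(K, ℂ) := ⟨fun θ => (∏ i, (R : ℂ) * Complex.exp ((θ : Fin N → ℝ) i * Complex.I)
    * Complex.I), continuous_finsetProd _ fun i _ =>
    (continuous_const.mul (Complex.continuous_exp.comp ((Complex.continuous_ofReal.comp
      ((continuous_apply i).comp continuous_subtype_val)).mul continuous_const))).mul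
      continuous_const⟩
  let F : C(K, ℂ) := ⟨fun θ => f (torusMap c (fun _ => R) θ), by
    refine continuous_iff_continuousAt.2 fun θ => ?_
    exact ContinuousAt.comp (f := fun θ : K => torusMap c (fun _ => R) θ)
      (hball (hmem θ)).continuousAt (hmap.comp continuous_subtype_val).continuousAt⟩
  let μ : Measure K := Measure.comap Subtype.val volume
  have : IsFiniteMeasure μ := by
    refine ⟨?_⟩
    rw [Measure.comap_apply _ Subtype.val_injective
      (fun s hs => (MeasurableEmbedding.subtype_coe measurableSet_Icc).measurableSet_image' hs)
      _ MeasurableSet.univ]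
    rw [image_univ, Subtype.range_coe]
    exact (isCompact_Icc : IsCompact K).measure_lt_top
  have hint : ∀ g : C(K, ℂ), Integrable g μ := fun g =>
    g.continuous.integrable_of_hasCompactSupport
      (HasCompactSupport.of_compactSpace _)
  let L₀ : C(K, ℂ) →ₗ[ℂ] ℂ :=
    { toFun := fun g => ∫ θ, g θ ∂μ
      map_add' := fun g h => integral_add (hint g) (hint h)
      map_smul' := fun a g => integral_const_mul a _ }
  let L : C(K, ℂ) →L[ℂ] ℂ := L₀.mkContinuous (μ.real univ) fun g => by
    have := norm_integral_le_of_norm_le_const (μ := μ) (f := g) (C := ‖g‖)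
      (Eventually.of_forall fun θ => g.norm_coe_le_norm θ)
    simpa [mul_comm, L₀] using this
  let A : (Fin N → ℂ) → Fin N → C(K, ℂ) := fun z l => W l - algebraMap ℂ C(K, ℂ) (z l)
  have hA : ∀ z ∈ Metric.ball c R, ∀ l, IsUnit (A z l) := by
    intro z hz l
    rw [ContinuousMap.isUnit_iff_forall_ne_zero]
    intro θ h
    have h1 : dist (z l) (c l) < R := (dist_pi_lt_iff hR).1 (Metric.mem_ball.1 hz) l
    have h2 : torusMap c (fun _ => R) θ l - z l = 0 := h
    rw [← sub_eq_zero.1 h2, dist_eq_norm] at h1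
    simp [torusMap, Complex.norm_exp_ofReal_mul_I, abs_of_pos hR] at h1
  have hinv : ∀ z ∈ Metric.ball c R, ∀ l (θ : K), (Ring.inverse (A z l)) θ =
      (torusMap c (fun _ => R) θ l - z l)⁻¹ := by
    intro z hz l θ
    have h1 := congrArg (fun g : C(K, ℂ) => g θ) (Ring.inverse_mul_cancel _ (hA z hz l))
    exact eq_inv_of_mul_eq_one_left h1
  have hAan : ∀ l, AnalyticAt ℂ (fun z => Ring.inverse (A z l)) c := by
    intro l
    obtain ⟨v, hv⟩ := hA c (Metric.mem_ball_self hR) l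
    have h1 : AnalyticAt ℂ (fun z : Fin N → ℂ => A z l) c := by
      refine analyticAt_const.sub ?_
      exact ((Algebra.linearMap ℂ C(K, ℂ)).toContinuousLinearMap.comp
        (ContinuousLinearMap.proj (R := ℂ) (φ := fun _ : Fin N => ℂ) l)).analyticAt c
    have h2 := analyticAt_inverse (𝕜 := ℂ) v
    rw [hv] at h2
    exact h2.comp (f := fun z => A z l) h1
  have hG : AnalyticAt ℂ (fun z => ((2 * Real.pi * Complex.I) ^ N)⁻¹ *
      L (D * ((∏ l, Ring.inverse (A z l)) * F))) c := by
    refine analyticAt_const.mul ?_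
    refine (L.analyticAt _).comp
      (f := fun z => D * ((∏ l, Ring.inverse (A z l)) * F)) ?_
    exact analyticAt_const.mul
      ((Finset.analyticAt_fun_prod _ fun l _ => hAan l).mul analyticAt_const)
  refine hG.congr ?_
  filter_upwards [Metric.ball_mem_nhds c hR] with z hz
  have hne : ((2 * Real.pi * Complex.I : ℂ) ^ N) ≠ 0 :=
    pow_ne_zero _ Complex.two_pi_I_ne_zero
  rw [inv_mul_eq_iff_eq_mul₀ hne, ← torusIntegral_prod_sub_inv_mul f c z hR hz hball,
    torusIntegral]
  change ∫ θ : K, _ ∂μ = _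
  rw [← integral_subtype_comap measurableSet_Icc]
  refine integral_congr_ae (Eventually.of_forall fun θ => ?_)
  simp only [ContinuousMap.mul_apply, ContinuousMap.prod_apply, hinv z hz, smul_eq_mul]
  rfl

/-- **Osgood's lemma**: a complex differentiable map between spaces `ℂ ^ N` is analytic. -/
theorem analyticAt_euclidean_of_eventually_differentiableAt {N m : ℕ}
    {f : EuclideanSpace ℂ (Fin N) → EuclideanSpace ℂ (Fin m)} {c : EuclideanSpace ℂ (Fin N)}
    (hf : ∀ᶠ w in 𝓝 c, DifferentiableAt ℂ f w) : AnalyticAt ℂ f c := by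
  let e := EuclideanSpace.equiv (Fin N) ℂ
  let e' := EuclideanSpace.equiv (Fin m) ℂ
  have h1 : ∀ l, AnalyticAt ℂ (fun z => e' (f (e.symm z)) l) (e c) := by
    intro l
    refine analyticAt_pi_of_eventually_differentiableAt ?_
    have : Tendsto e.symm (𝓝 (e c)) (𝓝 c) := by
      simpa using e.symm.continuous.tendsto (e c)
    filter_upwards [this.eventually hf] with w hw
    exact (((ContinuousLinearMap.proj (R := ℂ) (φ := fun _ : Fin m => ℂ) l).comp
      (e' : EuclideanSpace ℂ (Fin m) →L[ℂ] (Fin m → ℂ))).differentiableAt).comp w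
      (hw.comp w e.symm.differentiableAt)
  have h2 : AnalyticAt ℂ (fun z => e' (f (e.symm z))) (e c) := AnalyticAt.pi h1
  have h3 : AnalyticAt ℂ (fun z => e'.symm (e' (f (e.symm (e z))))) c :=
    ((e'.symm : (Fin m → ℂ) →L[ℂ] EuclideanSpace ℂ (Fin m)).analyticAt _).comp
      (AnalyticAt.comp (f := e) h2
        ((e : EuclideanSpace ℂ (Fin N) →L[ℂ] (Fin N → ℂ)).analyticAt c))
  simpa using h3

/-! ### Gluing open subsets of a vector space along closed relations -/

/-- Near `(p, q)`, the relation `C` is the graph of a map which is analytic at `p`. -/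
def IsAnalyticGraphAt {E : Type*} [NormedAddCommGroup E] [NormedSpace ℂ E] (C : Set (E × E))
    (p q : E) : Prop :=
  ∃ F : E → E, AnalyticAt ℂ F p ∧ F p = q ∧ ∀ᶠ z in 𝓝 (p, q), z ∈ C ↔ z.2 = F z.1

/-- Gluing data for a Hausdorff complex manifold modelled on `E`: nonempty open subsets `O i` of
`E` and relations `C i j` between them which fit together to an equivalence relation on the
disjoint union, are closed, and are locally graphs of analytic maps. The symmetry makes these maps
biholomorphic. The sets `C i j` may contain points outside `O i ×ˢ O j`; these play no role. -/
structure AnalyticGluing (ι : Type*) (E : Type*) [NormedAddCommGroup E] [NormedSpace ℂ E] where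
  /-- The pieces. -/
  O : ι → Set E
  /-- `(p, q) ∈ C i j` means that `p ∈ O i` is identified with `q ∈ O j`. -/
  C : ι → ι → Set (E × E)
  isOpen_O : ∀ i, IsOpen (O i)
  nonempty_O : ∀ i, (O i).Nonempty
  isClosed_C : ∀ i j, IsClosed (C i j)
  mem_C_self_iff : ∀ {i p q}, p ∈ O i → q ∈ O i → ((p, q) ∈ C i i ↔ p = q)
  symm : ∀ {i j p q}, p ∈ O i → q ∈ O j → (p, q) ∈ C i j → (q, p) ∈ C j i
  trans : ∀ {i j k p q r}, p ∈ O i → q ∈ O j → r ∈ O k →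
    (p, q) ∈ C i j → (q, r) ∈ C j k → (p, r) ∈ C i k
  isAnalyticGraphAt : ∀ {i j p q}, p ∈ O i → q ∈ O j → (p, q) ∈ C i j →
    IsAnalyticGraphAt (C i j) p q

namespace AnalyticGluing

variable {ι : Type*} {E : Type*} [NormedAddCommGroup E] [NormedSpace ℂ E]
  (G : AnalyticGluing ι E)

/-- The equivalence relation on the disjoint union of the pieces. -/
def setoid : Setoid (Σ i, G.O i) where
  r a b := (a.2.1, b.2.1) ∈ G.C a.1 b.1
  iseqv :=
    { refl := fun a => (G.mem_C_self_iff a.2.2 a.2.2).2 rfl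
      symm := fun {a b} h => G.symm a.2.2 b.2.2 h
      trans := fun {a b c} h h' => G.trans a.2.2 b.2.2 c.2.2 h h' }

/-- The glued space. -/
def Glued : Type _ := Quotient G.setoid

instance : TopologicalSpace G.Glued := inferInstanceAs (TopologicalSpace (Quotient G.setoid))

/-- The inclusion of a piece in the glued space. -/
def incl (i : ι) (p : G.O i) : G.Glued := Quotient.mk G.setoid ⟨i, p⟩

variable {G}

theorem incl_eq_incl_iff {i j : ι} {p : G.O i} {q : G.O j} :
    G.incl i p = G.incl j q ↔ (p.1, q.1) ∈ G.C i j :=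
  Quotient.eq (r := G.setoid)

theorem exists_incl_eq (x : G.Glued) : ∃ i p, G.incl i p = x := by
  obtain ⟨⟨i, p⟩, h⟩ := Quotient.exists_rep x
  exact ⟨i, p, h⟩

theorem continuous_incl (i : ι) : Continuous (G.incl i) :=
  (continuous_quotient_mk' (s := G.setoid)).comp continuous_sigmaMk

theorem incl_injective (i : ι) : Function.Injective (G.incl i) := fun p q h =>
  Subtype.ext ((G.mem_C_self_iff p.2 q.2).1 (incl_eq_incl_iff.1 h))

theorem isOpenMap_incl (i : ι) : IsOpenMap (G.incl i) := by
  intro W hW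
  obtain ⟨W', hW', rfl⟩ := isOpen_induced_iff.1 hW
  refine isOpen_coinduced.2 (isOpen_sigma_iff.2 fun j => isOpen_iff_mem_nhds.2 ?_)
  rintro q ⟨p, hp, hpq⟩
  have hC := G.symm p.2 q.2 (incl_eq_incl_iff.1 hpq)
  obtain ⟨F, hF, hFq, hgraph⟩ := G.isAnalyticGraphAt q.2 p.2 hC
  have hFt : Tendsto F (𝓝 q.1) (𝓝 p.1) := hFq ▸ hF.continuousAt
  have h1 : ∀ᶠ q' in 𝓝 q.1, (q', F q') ∈ G.C j i := by
    have := (tendsto_id.prodMk_nhds hFt).eventually hgraph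
    filter_upwards [this] with q' hq'
    exact hq'.2 rfl
  have h2 : ∀ᶠ q' in 𝓝 q.1, F q' ∈ W' ∩ G.O i :=
    hFt.eventually ((hW'.inter (G.isOpen_O i)).mem_nhds ⟨hp, p.2⟩)
  filter_upwards [continuous_subtype_val.continuousAt.eventually (h1.and h2)] with q' hq'
  refine ⟨⟨F q', hq'.2.2⟩, hq'.2.1, ?_⟩
  exact incl_eq_incl_iff.2 (G.symm q'.2 hq'.2.2 hq'.1)

theorem isOpenEmbedding_incl (i : ι) : Topology.IsOpenEmbedding (G.incl i) :=
  .of_continuous_injective_isOpenMap (continuous_incl i) (incl_injective i) (isOpenMap_incl i)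

instance : T2Space G.Glued := by
  refine ⟨fun x y hxy => ?_⟩
  obtain ⟨i, p, rfl⟩ := exists_incl_eq x
  obtain ⟨j, q, rfl⟩ := exists_incl_eq y
  have hC : (p.1, q.1) ∉ G.C i j := fun h => hxy (incl_eq_incl_iff.2 h)
  obtain ⟨V, W, hV, hW, hp, hq, hVW⟩ := isOpen_prod_iff.1 (G.isClosed_C i j).isOpen_compl _ _ hC
  refine ⟨_, _, isOpenMap_incl i _ (hV.preimage continuous_subtype_val),
    isOpenMap_incl j _ (hW.preimage continuous_subtype_val),
    mem_image_of_mem _ hp, mem_image_of_mem _ hq, Set.disjoint_left.2 ?_⟩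
  rintro _ ⟨p', hp', rfl⟩ ⟨q', hq', h⟩
  exact hVW (mk_mem_prod hp' hq') (incl_eq_incl_iff.1 h.symm)

instance [Countable ι] [SecondCountableTopology E] : SecondCountableTopology G.Glued := by
  have : ∀ i, SecondCountableTopology (range (G.incl i)) := fun i =>
    (isOpenEmbedding_incl i).toIsEmbedding.toHomeomorph.symm.secondCountableTopology
  refine secondCountableTopology_of_countable_cover
    (fun i => (isOpenMap_incl (G := G) i).isOpen_range) (eq_univ_of_forall fun x => ?_)
  obtain ⟨i, p, rfl⟩ := exists_incl_eq x
  exact mem_iUnion.2 ⟨i, p, rfl⟩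

variable (G) in
/-- The inverse of the inclusion of a piece, as a chart of the glued space. -/
noncomputable def chart (i : ι) : OpenPartialHomeomorph G.Glued E :=
  haveI : Nonempty (G.O i) := (G.nonempty_O i).to_subtype
  ((isOpenEmbedding_incl i).toOpenPartialHomeomorph (G.incl i)).symm.trans
    ((G.isOpen_O i).isOpenEmbedding_subtypeVal.toOpenPartialHomeomorph Subtype.val)

theorem chart_source (i : ι) : (G.chart i).source = range (G.incl i) := by
  simp [chart]

theorem chart_incl {i : ι} (p : G.O i) : G.chart i (G.incl i p) = p := by
  have : Nonempty (G.O i) := (G.nonempty_O i).to_subtype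
  have := ((isOpenEmbedding_incl i).toOpenPartialHomeomorph (G.incl i)).left_inv (mem_univ p)
  simpa [chart] using congrArg Subtype.val this

theorem chart_target (i : ι) : (G.chart i).target = G.O i := by
  have : Nonempty (G.O i) := (G.nonempty_O i).to_subtype
  simp [chart]

theorem chart_symm {i : ι} {p : E} (hp : p ∈ G.O i) : (G.chart i).symm p = G.incl i ⟨p, hp⟩ := by
  have h := (G.chart i).left_inv (x := G.incl i ⟨p, hp⟩) (by rw [chart_source]; exact ⟨_, rfl⟩)
  rwa [chart_incl] at h

noncomputable instance : ChartedSpace E G.Glued where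
  atlas := range G.chart
  chartAt x := G.chart (exists_incl_eq x).choose
  mem_chart_source x := by
    rw [chart_source]
    exact (exists_incl_eq x).choose_spec
  chart_mem_atlas x := ⟨_, rfl⟩

variable [CompleteSpace E]

theorem contDiffOn_chart_symm_trans_chart (i j : ι) :
    ContDiffOn ℂ ω ((G.chart i).symm.trans (G.chart j))
      ((G.chart i).symm.trans (G.chart j)).source := by
  intro p hp
  set T := (G.chart i).symm.trans (G.chart j) with hT
  have hmem : ∀ p' ∈ T.source, p' ∈ G.O i ∧ T p' ∈ G.O j ∧ (p', T p') ∈ G.C i j := by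
    intro p' hp'
    obtain ⟨h1, h2⟩ : p' ∈ (G.chart i).target ∧ (G.chart i).symm p' ∈ (G.chart j).source := by
      simpa [T, OpenPartialHomeomorph.trans_source] using hp'
    rw [chart_target] at h1
    rw [chart_symm h1, chart_source] at h2
    obtain ⟨q, hq⟩ := h2
    have h3 : T p' = q := by
      rw [hT, OpenPartialHomeomorph.coe_trans, Function.comp_apply, chart_symm h1, ← hq,
        chart_incl]
    exact ⟨h1, h3 ▸ q.2, h3 ▸ incl_eq_incl_iff.1 hq.symm⟩
  obtain ⟨h1, h2, h3⟩ := hmem p hp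
  obtain ⟨F, hF, hFp, hgraph⟩ := G.isAnalyticGraphAt h1 h2 h3
  refine ContDiffAt.contDiffWithinAt (hF.contDiffAt.congr_of_eventuallyEq ?_)
  have hcont : Tendsto (fun p' => (p', T p')) (𝓝 p) (𝓝 (p, T p)) :=
    tendsto_id.prodMk_nhds (T.continuousAt hp)
  filter_upwards [hcont.eventually hgraph, T.open_source.mem_nhds hp] with p' hp' hs
  exact hp'.1 (hmem p' hs).2.2

instance : IsManifold 𝓘(ℂ, E) ω G.Glued := by
  refine isManifold_of_contDiffOn _ _ _ ?_
  rintro _ _ ⟨i, rfl⟩ ⟨j, rfl⟩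
  simpa using contDiffOn_chart_symm_trans_chart (G := G) i j

theorem chart_mem_maximalAtlas (i : ι) :
    G.chart i ∈ IsManifold.maximalAtlas 𝓘(ℂ, E) ω G.Glued :=
  IsManifold.subset_maximalAtlas ⟨i, rfl⟩

end AnalyticGluing

/-! ### Germs of transition maps along a subspace -/

/-- `F` is analytic at `φ c` and `F ∘ φ = ψ` near `c`. -/
def IsTransitionAt {M E : Type*} [TopologicalSpace M] [NormedAddCommGroup E] [NormedSpace ℂ E]
    (φ ψ : M → E) (c : M) (F : E → E) : Prop :=
  AnalyticAt ℂ F (φ c) ∧ ∀ᶠ y in 𝓝 c, F (φ y) = ψ y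

/-- A locally finite family of compact sets `A i`, whose interiors cover `M`, together with
continuous injections `φ i` of open neighbourhoods `U i` of the `A i` into `E`, such that `φ j` is
locally the composition of `φ i` with an analytic map. The germ of an analytic map at `φ i c` is
required to be determined by its composition with `φ i`. -/
structure AnalyticThickening (ι M E : Type*) [TopologicalSpace M] [NormedAddCommGroup E]
    [NormedSpace ℂ E] where
  /-- The compact sets covering `M`. -/
  A : ι → Set M
  /-- The domains of the embeddings. -/
  U : ι → Set M
  /-- The local embeddings, of which only the values on `U i` matter. -/
  φ : ι → M → E
  isCompact_A : ∀ i, IsCompact (A i)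
  nonempty_A : ∀ i, (A i).Nonempty
  locallyFinite_A : LocallyFinite A
  exists_mem_interior_A : ∀ x, ∃ i, x ∈ interior (A i)
  isOpen_U : ∀ i, IsOpen (U i)
  A_subset_U : ∀ i, A i ⊆ U i
  continuousOn_φ : ∀ i, ContinuousOn (φ i) (U i)
  injOn_φ : ∀ i, InjOn (φ i) (U i)
  exists_isTransitionAt : ∀ {i j c}, c ∈ U i → c ∈ U j → ∃ F : E → E,
    IsTransitionAt (φ i) (φ j) c F
  eventuallyEq : ∀ {i} {c} {F G : E → E}, c ∈ U i → AnalyticAt ℂ F (φ i c) → AnalyticAt ℂ G (φ i c) →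
    (∀ᶠ y in 𝓝 c, F (φ i y) = G (φ i y)) → F =ᶠ[𝓝 (φ i c)] G

namespace AnalyticThickening

variable {ι M E : Type*} [TopologicalSpace M] [NormedAddCommGroup E] [NormedSpace ℂ E]
  (D : AnalyticThickening ι M E)

theorem continuousAt_φ {i : ι} {x : M} (hx : x ∈ D.U i) : ContinuousAt (D.φ i) x :=
  (D.continuousOn_φ i).continuousAt ((D.isOpen_U i).mem_nhds hx)

theorem isCompact_image_A (i : ι) : IsCompact (D.φ i '' D.A i) :=
  (D.isCompact_A i).image_of_continuousOn ((D.continuousOn_φ i).mono (D.A_subset_U i))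

theorem isTransitionAt_id {i : ι} {c : M} : IsTransitionAt (D.φ i) (D.φ i) c id :=
  ⟨analyticAt_id, Eventually.of_forall fun _ => rfl⟩

theorem transition_eventuallyEq {i j : ι} {c : M} {F G : E → E} (hc : c ∈ D.U i)
    (hF : IsTransitionAt (D.φ i) (D.φ j) c F) (hG : IsTransitionAt (D.φ i) (D.φ j) c G) :
    F =ᶠ[𝓝 (D.φ i c)] G :=
  D.eventuallyEq hc hF.1 hG.1 (by filter_upwards [hF.2, hG.2] with y h1 h2 using h1.trans h2.symm)

theorem _root_.IsTransitionAt.comp {φ ψ χ : M → E} {c : M} {F G : E → E}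
    (hG : IsTransitionAt ψ χ c G) (hF : IsTransitionAt φ ψ c F) :
    IsTransitionAt φ χ c (G ∘ F) := by
  have h := hF.2.self_of_nhds
  refine ⟨AnalyticAt.comp (h.symm ▸ hG.1) hF.1, ?_⟩
  filter_upwards [hF.2, hG.2] with y h1 h2
  simp [h1, h2]

/-- Transition germs along `A i ∩ A j` are represented by a compact relation which meets
`φ i (A i) × φ j (A j)` only in the pairs `(φ i x, φ j x)`: a finite union of graphs over small
closed balls. -/
theorem exists_relation [T2Space M] [ProperSpace E] (i j : ι) : ∃ C : Set (E × E), IsClosed C ∧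
    (C.Nonempty → (D.A i ∩ D.A j).Nonempty) ∧
    (∀ x ∈ D.A i, ∀ y ∈ D.A j, (D.φ i x, D.φ j y) ∈ C → x = y) ∧
    ∀ x ∈ D.A i ∩ D.A j, ∀ F, IsTransitionAt (D.φ i) (D.φ j) x F →
      ∀ᶠ z in 𝓝 (D.φ i x, D.φ j x), z ∈ C ↔ z.2 = F z.1 := by
  -- For each `c` there are a transition map `F`, valid on `W`, and a ball around `φ i c` on which
  -- `F` is analytic and which meets `φ i (A i)` in a subset of `φ i W`.
  have key : ∀ c ∈ D.A i ∩ D.A j, ∃ (F : E → E) (W : Set M) (r : ℝ), 0 < r ∧ IsOpen W ∧ c ∈ W ∧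
      W ⊆ D.U j ∧ (∀ y ∈ W, F (D.φ i y) = D.φ j y) ∧
      (∀ p ∈ Metric.closedBall (D.φ i c) r, AnalyticAt ℂ F p) ∧
      ∀ x ∈ D.A i, D.φ i x ∈ Metric.closedBall (D.φ i c) r → x ∈ W := by
    rintro c ⟨hci, hcj⟩
    obtain ⟨F, hF, hFφ⟩ := D.exists_isTransitionAt (D.A_subset_U i hci) (D.A_subset_U j hcj)
    obtain ⟨W, hWs, hW, hcW⟩ := eventually_nhds_iff.1
      (hFφ.and ((D.isOpen_U j).mem_nhds (D.A_subset_U j hcj)))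
    have hcpt : IsCompact (D.φ i '' (D.A i \ W)) :=
      ((D.isCompact_A i).diff hW).image_of_continuousOn
        ((D.continuousOn_φ i).mono (sdiff_subset.trans (D.A_subset_U i)))
    have hnot : D.φ i c ∉ D.φ i '' (D.A i \ W) := by
      rintro ⟨x, hx, hxc⟩
      exact hx.2 (D.injOn_φ i (D.A_subset_U i hx.1) (D.A_subset_U i hci) hxc ▸ hcW)
    obtain ⟨r, hr, hball⟩ := Metric.nhds_basis_closedBall.mem_iff.1
      (hF.eventually_analyticAt.and (hcpt.isClosed.isOpen_compl.mem_nhds hnot))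
    refine ⟨F, W, r, hr, hW, hcW, fun y hy => (hWs y hy).2, fun y hy => (hWs y hy).1,
      fun p hp => (hball hp).1, fun x hx hxr => ?_⟩
    by_contra hxW
    exact (hball hxr).2 ⟨x, ⟨hx, hxW⟩, rfl⟩
  choose! F W r hr hW hcW hWU hFφ hFan hAW using key
  obtain ⟨t, ht, hcov⟩ := ((D.isCompact_A i).inter (D.isCompact_A j)).elim_nhds_subcover
    (fun c => D.φ i ⁻¹' Metric.ball (D.φ i c) (r c)) fun c hc =>
      (D.continuousAt_φ (D.A_subset_U i hc.1)).preimage_mem_nhds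
        (Metric.ball_mem_nhds _ (hr c hc))
  refine ⟨⋃ c ∈ t, (fun p => (p, F c p)) '' Metric.closedBall (D.φ i c) (r c), ?_, ?_, ?_, ?_⟩
  · refine IsCompact.isClosed (t.isCompact_biUnion fun c hc => ?_)
    refine (isCompact_closedBall _ _).image_of_continuousOn ?_
    exact continuousOn_id.prodMk fun p hp =>
      (hFan c (ht c hc) p hp).continuousAt.continuousWithinAt
  · rintro ⟨z, hz⟩
    obtain ⟨c, hc, -⟩ := mem_iUnion₂.1 hz
    exact ⟨c, ht c hc⟩
  · intro x hx y hy hxy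
    obtain ⟨c, hc, p, hp, hpz⟩ := mem_iUnion₂.1 hxy
    obtain ⟨rfl, h2⟩ := Prod.mk.inj hpz
    have hxW := hAW c (ht c hc) x hx hp
    rw [hFφ c (ht c hc) x hxW] at h2
    exact D.injOn_φ j (hWU c (ht c hc) hxW) (D.A_subset_U j hy) h2
  · rintro x ⟨hxi, hxj⟩ H hH
    have hxU := D.A_subset_U i hxi
    have h1 : ∀ c ∈ t, ∀ᶠ p in 𝓝 (D.φ i x),
        p ∈ Metric.closedBall (D.φ i c) (r c) → F c p = H p := by
      intro c hc
      by_cases hxc : D.φ i x ∈ Metric.closedBall (D.φ i c) (r c)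
      · have hxW := hAW c (ht c hc) x hxi hxc
        have := D.transition_eventuallyEq hxU (F := F c) ⟨hFan c (ht c hc) _ hxc, by
          filter_upwards [(hW c (ht c hc)).mem_nhds hxW] with y hy
          exact hFφ c (ht c hc) y hy⟩ hH
        filter_upwards [this] with p hp _ using hp
      · filter_upwards [Metric.isClosed_closedBall.isOpen_compl.mem_nhds hxc] with p hp hp'
        exact absurd hp' hp
    obtain ⟨c₀, hc₀, hx₀⟩ := mem_iUnion₂.1 (hcov ⟨hxi, hxj⟩)
    have h2 : ∀ᶠ p in 𝓝 (D.φ i x), p ∈ Metric.ball (D.φ i c₀) (r c₀) :=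
      Metric.isOpen_ball.mem_nhds hx₀
    have h3 := ((Filter.eventually_all_finset t).2 h1).and h2
    filter_upwards [(continuous_fst.tendsto (D.φ i x, D.φ j x)).eventually h3] with z hz
    constructor
    · intro hzC
      obtain ⟨c, hc, p, hp, rfl⟩ := mem_iUnion₂.1 hzC
      exact hz.1 c hc hp
    · intro hzH
      have hb := Metric.ball_subset_closedBall hz.2
      exact mem_iUnion₂.2 ⟨c₀, hc₀, z.1, hb, Prod.ext rfl (by rw [hzH]; exact hz.1 c₀ hc₀ hb)⟩

theorem exists_transition {i j : ι} {x : M} (hi : x ∈ D.A i) (hj : x ∈ D.A j) :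
    ∃ F, IsTransitionAt (D.φ i) (D.φ j) x F :=
  D.exists_isTransitionAt (D.A_subset_U i hi) (D.A_subset_U j hj)

/-- The indices of the compact sets which meet `A i`. -/
def neighbors (i : ι) : Set ι := {j | (D.A j ∩ D.A i).Nonempty}

theorem finite_neighbors (i : ι) : (D.neighbors i).Finite :=
  D.locallyFinite_A.finite_nonempty_inter_compact (D.isCompact_A i)

theorem self_mem_neighbors (i : ι) : i ∈ D.neighbors i := by
  simpa [neighbors] using D.nonempty_A i

theorem exists_mem_A (x : M) : ∃ i, x ∈ D.A i :=
  (D.exists_mem_interior_A x).imp fun _ h => interior_subset h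

section Relation

variable [T2Space M] [ProperSpace E]

/-- A choice of compact relations representing the transition germs. -/
noncomputable def rel (i j : ι) : Set (E × E) := (D.exists_relation i j).choose

theorem isClosed_rel (i j : ι) : IsClosed (D.rel i j) := (D.exists_relation i j).choose_spec.1

theorem inter_nonempty_of_mem_rel {i j : ι} {z : E × E} (h : z ∈ D.rel i j) :
    (D.A i ∩ D.A j).Nonempty :=
  (D.exists_relation i j).choose_spec.2.1 ⟨z, h⟩

theorem eq_of_mem_rel {i j : ι} {x y : M} (hx : x ∈ D.A i) (hy : y ∈ D.A j)
    (h : (D.φ i x, D.φ j y) ∈ D.rel i j) : x = y :=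
  (D.exists_relation i j).choose_spec.2.2.1 x hx y hy h

theorem eventually_mem_rel_iff {i j : ι} {x : M} (hi : x ∈ D.A i) (hj : x ∈ D.A j) {F : E → E}
    (hF : IsTransitionAt (D.φ i) (D.φ j) x F) :
    ∀ᶠ z in 𝓝 (D.φ i x, D.φ j x), z ∈ D.rel i j ↔ z.2 = F z.1 :=
  (D.exists_relation i j).choose_spec.2.2.2 x ⟨hi, hj⟩ F hF

theorem mem_rel {i j : ι} {x : M} (hi : x ∈ D.A i) (hj : x ∈ D.A j) :
    (D.φ i x, D.φ j x) ∈ D.rel i j := by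
  obtain ⟨F, hF⟩ := D.exists_transition hi hj
  exact (D.eventually_mem_rel_iff hi hj hF).self_of_nhds.2 hF.2.self_of_nhds.symm

/-- The conditions on a triple of points under which the chosen relations behave like an
equivalence relation generated by local biholomorphisms. -/
structure IsGood (i j k : ι) (p q r : E) : Prop where
  symm : (p, q) ∈ D.rel i j → (q, p) ∈ D.rel j i
  graph : (p, q) ∈ D.rel i j → IsAnalyticGraphAt (D.rel i j) p q
  trans : (p, q) ∈ D.rel i j → (q, r) ∈ D.rel j k → (p, r) ∈ D.rel i k
  self_iff : i = j → ((p, q) ∈ D.rel i j ↔ p = q)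

theorem eventually_symm_graph {i j : ι} {x y : M} (hx : x ∈ D.A i) (hy : y ∈ D.A j) :
    ∀ᶠ z in 𝓝 (D.φ i x, D.φ j y), z ∈ D.rel i j →
      z.swap ∈ D.rel j i ∧ IsAnalyticGraphAt (D.rel i j) z.1 z.2 := by
  by_cases hxy : x = y
  · subst hxy
    obtain ⟨F, hF⟩ := D.exists_transition hx hy
    obtain ⟨G, hG⟩ := D.exists_transition hy hx
    have hGF : ∀ᶠ p in 𝓝 (D.φ i x), G (F p) = p :=
      D.transition_eventuallyEq (D.A_subset_U i hx) (hG.comp hF) D.isTransitionAt_id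
    have h1 := D.eventually_mem_rel_iff hx hy hF
    have h2 := (continuous_swap.tendsto (D.φ i x, D.φ j x)).eventually
      (D.eventually_mem_rel_iff hy hx hG)
    have h3 := (continuous_fst.tendsto (D.φ i x, D.φ j x)).eventually
      (hGF.and hF.1.eventually_analyticAt)
    filter_upwards [h1.eventually_nhds, h2, h3] with z hz1 hz2 hz3 hz
    have hzF := hz1.self_of_nhds.1 hz
    refine ⟨hz2.2 ?_, F, hz3.2, hzF.symm, hz1⟩
    simp [hzF, hz3.1]
  · have : (D.φ i x, D.φ j y) ∉ D.rel i j := fun h => hxy (D.eq_of_mem_rel hx hy h)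
    filter_upwards [(D.isClosed_rel i j).isOpen_compl.mem_nhds this] with z hz hz'
    exact absurd hz' hz

theorem eventually_trans {i j k : ι} {x y w : M} (hx : x ∈ D.A i) (hy : y ∈ D.A j)
    (hw : w ∈ D.A k) : ∀ᶠ z : E × E × E in 𝓝 (D.φ i x, D.φ j y, D.φ k w),
      (z.1, z.2.1) ∈ D.rel i j → z.2 ∈ D.rel j k → (z.1, z.2.2) ∈ D.rel i k := by
  have t12 : Tendsto (fun z : E × E × E => (z.1, z.2.1)) (𝓝 (D.φ i x, D.φ j y, D.φ k w))
      (𝓝 (D.φ i x, D.φ j y)) :=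
    Continuous.tendsto (f := fun z : E × E × E => (z.1, z.2.1)) (by fun_prop) _
  have t13 : Tendsto (fun z : E × E × E => (z.1, z.2.2)) (𝓝 (D.φ i x, D.φ j y, D.φ k w))
      (𝓝 (D.φ i x, D.φ k w)) :=
    Continuous.tendsto (f := fun z : E × E × E => (z.1, z.2.2)) (by fun_prop) _
  have t23 : Tendsto (fun z : E × E × E => z.2) (𝓝 (D.φ i x, D.φ j y, D.φ k w))
      (𝓝 (D.φ j y, D.φ k w)) := continuous_snd.tendsto _
  by_cases hxy : x = y
  · by_cases hyw : y = w
    · subst hxy hyw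
      obtain ⟨F, hF⟩ := D.exists_transition hx hy
      obtain ⟨G, hG⟩ := D.exists_transition hy hw
      have h1 := t12.eventually (D.eventually_mem_rel_iff hx hy hF)
      have h2 := t23.eventually (D.eventually_mem_rel_iff hy hw hG)
      have h3 := t13.eventually (D.eventually_mem_rel_iff hx hw (hG.comp hF))
      filter_upwards [h1, h2, h3] with z hz1 hz2 hz3 h h'
      rw [hz3, hz2.1 h', hz1.1 h]
      rfl
    · have : (D.φ j y, D.φ k w) ∉ D.rel j k := fun h => hyw (D.eq_of_mem_rel hy hw h)
      filter_upwards [t23.eventually ((D.isClosed_rel j k).isOpen_compl.mem_nhds this)]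
        with z hz _ hz'
      exact absurd hz' hz
  · have : (D.φ i x, D.φ j y) ∉ D.rel i j := fun h => hxy (D.eq_of_mem_rel hx hy h)
    filter_upwards [t12.eventually ((D.isClosed_rel i j).isOpen_compl.mem_nhds this)]
      with z hz hz'
    exact absurd hz' hz

theorem eventually_self_iff {i : ι} {x y : M} (hx : x ∈ D.A i) (hy : y ∈ D.A i) :
    ∀ᶠ z in 𝓝 (D.φ i x, D.φ i y), z ∈ D.rel i i ↔ z.1 = z.2 := by
  by_cases hxy : x = y
  · subst hxy
    filter_upwards [D.eventually_mem_rel_iff hx hx D.isTransitionAt_id] with z hz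
    rw [hz, id, eq_comm]
  · have h1 : (D.φ i x, D.φ i y) ∉ D.rel i i := fun h => hxy (D.eq_of_mem_rel hx hy h)
    have h2 : D.φ i x ≠ D.φ i y := fun h =>
      hxy (D.injOn_φ i (D.A_subset_U i hx) (D.A_subset_U i hy) h)
    filter_upwards [(D.isClosed_rel i i).isOpen_compl.mem_nhds h1,
      (isOpen_ne_fun continuous_fst continuous_snd).mem_nhds h2] with z hz hz'
    exact ⟨fun h => absurd h hz, fun h => absurd h hz'⟩

theorem eventually_isGood {i j k : ι} {x y w : M} (hx : x ∈ D.A i) (hy : y ∈ D.A j)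
    (hw : w ∈ D.A k) : ∀ᶠ z : E × E × E in 𝓝 (D.φ i x, D.φ j y, D.φ k w),
      D.IsGood i j k z.1 z.2.1 z.2.2 := by
  have t12 : Tendsto (fun z : E × E × E => (z.1, z.2.1)) (𝓝 (D.φ i x, D.φ j y, D.φ k w))
      (𝓝 (D.φ i x, D.φ j y)) :=
    Continuous.tendsto (f := fun z : E × E × E => (z.1, z.2.1)) (by fun_prop) _
  have h3 : ∀ᶠ z in 𝓝 (D.φ i x, D.φ j y), i = j → (z ∈ D.rel i j ↔ z.1 = z.2) := by
    by_cases hij : i = j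
    · subst hij
      filter_upwards [D.eventually_self_iff hx hy] with z hz _ using hz
    · exact Eventually.of_forall fun z h => absurd h hij
  filter_upwards [t12.eventually (D.eventually_symm_graph hx hy), t12.eventually h3,
    D.eventually_trans hx hy hw] with z h1 h2 h3
  exact ⟨fun h => (h1 h).1, fun h => (h1 h).2, h3, h2⟩

theorem exists_thickening_isGood (i j k : ι) : ∃ ε > 0,
    ∀ p ∈ Metric.thickening ε (D.φ i '' D.A i), ∀ q ∈ Metric.thickening ε (D.φ j '' D.A j),
      ∀ r ∈ Metric.thickening ε (D.φ k '' D.A k), D.IsGood i j k p q r := by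
  have hK := (D.isCompact_image_A i).prod ((D.isCompact_image_A j).prod (D.isCompact_image_A k))
  obtain ⟨ε, hε, hsub⟩ := hK.exists_thickening_subset_open
    (isOpen_interior (s := {z : E × E × E | D.IsGood i j k z.1 z.2.1 z.2.2})) (by
      rintro ⟨_, _, _⟩ ⟨⟨x, hx, rfl⟩, ⟨y, hy, rfl⟩, ⟨w, hw, rfl⟩⟩
      exact mem_interior_iff_mem_nhds.2 (D.eventually_isGood hx hy hw))
  refine ⟨ε, hε, fun p hp q hq r hr => ?_⟩
  obtain ⟨p', hp', h1⟩ := Metric.mem_thickening_iff.1 hp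
  obtain ⟨q', hq', h2⟩ := Metric.mem_thickening_iff.1 hq
  obtain ⟨r', hr', h3⟩ := Metric.mem_thickening_iff.1 hr
  have : (p, q, r) ∈ Metric.thickening ε
      ((D.φ i '' D.A i) ×ˢ (D.φ j '' D.A j) ×ˢ (D.φ k '' D.A k)) :=
    Metric.mem_thickening_iff.2 ⟨(p', q', r'), ⟨hp', hq', hr'⟩, by simp [Prod.dist_eq, *]⟩
  have hgood := interior_subset (hsub this)
  exact hgood

end Relation

end AnalyticThickening

/-! ### The thickening as a complex manifold -/

namespace AnalyticThickening

variable {ι M E : Type*} [TopologicalSpace M] [T2Space M] [NormedAddCommGroup E]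
  [NormedSpace ℂ E] [ProperSpace E] (D : AnalyticThickening ι M E)

/-- By local finiteness, the radii of the thickenings can be chosen so that each of them satisfies
the finitely many conditions coming from triples of charts which can interact. -/
theorem exists_radius : ∃ δ : ι → ℝ, (∀ i, 0 < δ i) ∧ ∀ i j k,
    j ∈ D.neighbors i → k ∈ D.neighbors j →
    ∀ p ∈ Metric.thickening (δ i) (D.φ i '' D.A i),
      ∀ q ∈ Metric.thickening (δ j) (D.φ j '' D.A j),
        ∀ r ∈ Metric.thickening (δ k) (D.φ k '' D.A k), D.IsGood i j k p q r := by
  choose ε hε hgood using D.exists_thickening_isGood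
  let S : ι → Set ι := fun i => ⋃ j ∈ D.neighbors i, D.neighbors j
  have hS : ∀ i, (S i).Finite := fun i =>
    (D.finite_neighbors i).biUnion fun j _ => D.finite_neighbors j
  have hsymm : ∀ {i j}, j ∈ D.neighbors i → i ∈ D.neighbors j := fun {i j} h => by
    rwa [neighbors, mem_ofPred_eq, inter_comm]
  have hmem : ∀ {i j k}, j ∈ D.neighbors i → k ∈ D.neighbors j → k ∈ S i := fun h h' =>
    mem_iUnion₂.2 ⟨_, h, h'⟩
  have hδ : ∀ i, ∃ δ > 0, ∀ a ∈ S i, ∀ b ∈ S i, ∀ c ∈ S i, δ ≤ ε a b c := by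
    intro i
    have : ∀ᶠ δ in 𝓝[>] (0 : ℝ), ∀ a ∈ S i, ∀ b ∈ S i, ∀ c ∈ S i, δ ≤ ε a b c :=
      (eventually_all_finite (hS i)).2 fun a _ => (eventually_all_finite (hS i)).2 fun b _ =>
        (eventually_all_finite (hS i)).2 fun c _ =>
          eventually_nhdsWithin_of_eventually_nhds (eventually_le_nhds (hε a b c))
    obtain ⟨δ, h1, h2⟩ := (this.and self_mem_nhdsWithin).exists
    exact ⟨δ, h2, h1⟩
  choose δ hδ0 hδ using hδ
  refine ⟨δ, hδ0, fun i j k hij hjk p hp q hq r hr => hgood i j k p ?_ q ?_ r ?_⟩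
  · exact Metric.thickening_mono (hδ i _ (hmem (D.self_mem_neighbors i) (D.self_mem_neighbors i)) _ (hmem (D.self_mem_neighbors i) hij) _
      (hmem hij hjk)) _ hp
  · exact Metric.thickening_mono (hδ j _ (hmem (D.self_mem_neighbors j) (hsymm hij)) _
      (hmem (D.self_mem_neighbors j) (D.self_mem_neighbors j)) _ (hmem (D.self_mem_neighbors j) hjk)) _ hq
  · exact Metric.thickening_mono (hδ k _ (hmem (hsymm hjk) (hsymm hij)) _
      (hmem (D.self_mem_neighbors k) (hsymm hjk)) _ (hmem (D.self_mem_neighbors k) (D.self_mem_neighbors k))) _ hr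

/-- Radii of neighbourhoods of the compact sets `φ i (A i)` on which the chosen relations form an
equivalence relation. -/
noncomputable def radius : ι → ℝ := D.exists_radius.choose

theorem radius_pos (i : ι) : 0 < D.radius i := D.exists_radius.choose_spec.1 i

/-- The piece of the thickening around `A i`. -/
def piece (i : ι) : Set E := Metric.thickening (D.radius i) (D.φ i '' D.A i)

theorem mem_piece {i : ι} {x : M} (hx : x ∈ D.A i) : D.φ i x ∈ D.piece i :=
  Metric.self_subset_thickening (D.radius_pos i) _ (mem_image_of_mem _ hx)

theorem mem_neighbors_of_mem_rel {i j : ι} {z : E × E} (h : z ∈ D.rel i j) :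
    j ∈ D.neighbors i := by
  rw [neighbors, mem_ofPred_eq, inter_comm]
  exact D.inter_nonempty_of_mem_rel h

theorem isGood_of_mem_rel {i j k : ι} {p q r : E} {z : E × E} (hp : p ∈ D.piece i)
    (hq : q ∈ D.piece j) (hr : r ∈ D.piece k) (hij : j ∈ D.neighbors i) (h : z ∈ D.rel j k) :
    D.IsGood i j k p q r :=
  D.exists_radius.choose_spec.2 i j k hij (D.mem_neighbors_of_mem_rel h) p hp q hq r hr

theorem isGood_self {i j : ι} {p q : E} (hp : p ∈ D.piece i) (hq : q ∈ D.piece j)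
    (hij : j ∈ D.neighbors i) : D.IsGood i j j p q q :=
  D.exists_radius.choose_spec.2 i j j hij (D.self_mem_neighbors j) p hp q hq q hq

/-- The pieces around the `A i`, glued along the chosen relations. -/
noncomputable def gluing : AnalyticGluing ι E where
  O := D.piece
  C := D.rel
  isOpen_O _ := Metric.isOpen_thickening
  nonempty_O i := (D.nonempty_A i).elim fun _ hx => ⟨_, D.mem_piece hx⟩
  isClosed_C := D.isClosed_rel
  mem_C_self_iff {i _ _} hp hq := (D.isGood_self hp hq (D.self_mem_neighbors i)).self_iff rfl
  symm hp hq h := (D.isGood_self hp hq (D.mem_neighbors_of_mem_rel h)).symm h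
  trans hp hq hr h h' :=
    (D.isGood_of_mem_rel hp hq hr (D.mem_neighbors_of_mem_rel h) h').trans h h'
  isAnalyticGraphAt hp hq h := (D.isGood_self hp hq (D.mem_neighbors_of_mem_rel h)).graph h

/-- The complex manifold obtained by thickening `M`. -/
abbrev Thickened : Type _ := D.gluing.Glued

/-- The inclusion of `M` in its thickening. -/
noncomputable def toThickened (x : M) : D.Thickened :=
  D.gluing.incl (D.exists_mem_A x).choose ⟨_, D.mem_piece (D.exists_mem_A x).choose_spec⟩

theorem toThickened_eq {i : ι} {x : M} (hx : x ∈ D.A i) :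
    D.toThickened x = D.gluing.incl i ⟨_, D.mem_piece hx⟩ :=
  AnalyticGluing.incl_eq_incl_iff.2 (D.mem_rel (D.exists_mem_A x).choose_spec hx)

theorem toThickened_mem_chart_source {i : ι} {x : M} (hx : x ∈ D.A i) :
    D.toThickened x ∈ (D.gluing.chart i).source := by
  rw [D.toThickened_eq hx, AnalyticGluing.chart_source]
  exact mem_range_self _

theorem chart_toThickened {i : ι} {x : M} (hx : x ∈ D.A i) :
    D.gluing.chart i (D.toThickened x) = D.φ i x := by
  rw [D.toThickened_eq hx, AnalyticGluing.chart_incl]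

theorem continuousOn_toThickened (i : ι) : ContinuousOn D.toThickened (D.A i) := by
  have h : ContinuousOn (fun x => (D.gluing.chart i).symm (D.φ i x)) (D.A i) := by
    refine (D.gluing.chart i).symm.continuousOn.comp
      ((D.continuousOn_φ i).mono (D.A_subset_U i)) fun x hx => ?_
    rw [OpenPartialHomeomorph.symm_source, AnalyticGluing.chart_target]
    exact D.mem_piece hx
  refine h.congr fun x hx => ?_
  change _ = (D.gluing.chart i).symm (D.φ i x)
  rw [AnalyticGluing.chart_symm (D.mem_piece hx), D.toThickened_eq hx]

theorem continuous_toThickened : Continuous D.toThickened :=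
  continuous_iff_continuousAt.2 fun x =>
    (D.exists_mem_interior_A x).elim fun i hi =>
      (D.continuousOn_toThickened i).continuousAt (mem_interior_iff_mem_nhds.1 hi)

theorem toThickened_injective : Function.Injective D.toThickened := by
  intro x y h
  obtain ⟨i, hi⟩ := D.exists_mem_A x
  obtain ⟨j, hj⟩ := D.exists_mem_A y
  rw [D.toThickened_eq hi, D.toThickened_eq hj] at h
  exact D.eq_of_mem_rel hi hj (AnalyticGluing.incl_eq_incl_iff.1 h)

/-- The images of the compact sets `A i` form a locally finite family in the thickening, since the
piece around `A i` meets the image of `A j` only if `A i` meets `A j`. -/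
theorem isClosedMap_toThickened : IsClosedMap D.toThickened := by
  intro s hs
  have hs' : D.toThickened '' s = ⋃ i, D.toThickened '' (s ∩ D.A i) := by
    rw [← image_iUnion, ← inter_iUnion,
      eq_univ_of_forall fun x => mem_iUnion.2 (D.exists_mem_A x), inter_univ]
  rw [hs']
  refine LocallyFinite.isClosed_iUnion (fun z => ?_) fun i => ?_
  · obtain ⟨i, p, rfl⟩ := AnalyticGluing.exists_incl_eq z
    refine ⟨range (D.gluing.incl i),
      (AnalyticGluing.isOpenMap_incl i).isOpen_range.mem_nhds (mem_range_self _),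
      (D.finite_neighbors i).subset ?_⟩
    rintro j ⟨_, ⟨y, hy, rfl⟩, ⟨q, hq⟩⟩
    rw [D.toThickened_eq hy.2] at hq
    exact D.mem_neighbors_of_mem_rel (AnalyticGluing.incl_eq_incl_iff.1 hq)
  · exact (((D.isCompact_A i).inter_left hs).image_of_continuousOn
      ((D.continuousOn_toThickened i).mono inter_subset_right)).isClosed

theorem isClosedEmbedding_toThickened : Topology.IsClosedEmbedding D.toThickened :=
  .of_continuous_injective_isClosedMap D.continuous_toThickened D.toThickened_injective
    D.isClosedMap_toThickened

/-- Every point of the thickening lies in a ball centred at a point of `M`. -/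
instance [ConnectedSpace M] : ConnectedSpace D.Thickened := by
  obtain ⟨x₀⟩ := (inferInstance : Nonempty M)
  have hrange : IsPreconnected (range D.toThickened) :=
    isPreconnected_range D.continuous_toThickened
  have : PreconnectedSpace D.Thickened := by
    refine ⟨isPreconnected_of_forall (D.toThickened x₀) fun z _ => ?_⟩
    obtain ⟨i, p, rfl⟩ := AnalyticGluing.exists_incl_eq z
    obtain ⟨_, ⟨x, hx, rfl⟩, hpx⟩ := Metric.mem_thickening_iff.1 p.2
    have hball : Metric.ball (D.φ i x) (D.radius i) ⊆ (D.gluing.chart i).symm.source := by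
      rw [OpenPartialHomeomorph.symm_source, AnalyticGluing.chart_target]
      exact fun q hq => Metric.mem_thickening_iff.2 ⟨_, mem_image_of_mem _ hx, hq⟩
    have hb := ((convex_ball (D.φ i x) (D.radius i)).isPreconnected).image _
      ((D.gluing.chart i).symm.continuousOn.mono hball)
    have hx' : D.toThickened x ∈
        (D.gluing.chart i).symm '' Metric.ball (D.φ i x) (D.radius i) :=
      ⟨_, Metric.mem_ball_self (D.radius_pos i), by
        rw [AnalyticGluing.chart_symm (D.mem_piece hx), D.toThickened_eq hx]⟩
    refine ⟨_, subset_univ _, Or.inl (mem_range_self x₀), Or.inr ⟨p, hpx, ?_⟩,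
      hrange.union (D.toThickened x) (mem_range_self x) hx' hb⟩
    rw [AnalyticGluing.chart_symm p.2]
  exact { toNonempty := ⟨D.toThickened x₀⟩ }

instance [Countable ι] : ParacompactSpace D.Thickened := by
  have : LocallyCompactSpace D.Thickened := ChartedSpace.locallyCompactSpace E _
  infer_instance

end AnalyticThickening

/-! ### Countable locally finite compact coverings -/

/-- A covering of a connected space by nonempty open sets, each of which meets only finitely many
others, is countable: every member is reached from a given one by a finite chain of intersecting
members. -/
theorem countable_of_finite_inter {M ι : Type*} [TopologicalSpace M] [ConnectedSpace M]
    {v : ι → Set M} (ho : ∀ i, IsOpen (v i)) (hne : ∀ i, (v i).Nonempty)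
    (hcov : ⋃ i, v i = univ) (hfin : ∀ i, {j | (v j ∩ v i).Nonempty}.Finite) : Countable ι := by
  obtain ⟨x₀⟩ := (inferInstance : Nonempty M)
  obtain ⟨i₀, hi₀⟩ := mem_iUnion.1 (hcov ▸ mem_univ x₀)
  let R : ℕ → Set ι := fun m =>
    Nat.rec {i₀} (fun _ S => ⋃ i ∈ S, {j | (v j ∩ v i).Nonempty}) m
  have hRfin : ∀ m, (R m).Finite := by
    intro m
    induction m with
    | zero => exact finite_singleton i₀
    | succ m ih => exact ih.biUnion fun i _ => hfin i
  have hstep : ∀ i ∈ ⋃ m, R m, ∀ j, (v j ∩ v i).Nonempty → j ∈ ⋃ m, R m := by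
    intro i hi j hj
    obtain ⟨m, hm⟩ := mem_iUnion.1 hi
    exact mem_iUnion.2 ⟨m + 1, mem_iUnion₂.2 ⟨i, hm, hj⟩⟩
  have hclopen : IsClopen (⋃ i ∈ ⋃ m, R m, v i) := by
    refine ⟨⟨?_⟩, isOpen_biUnion fun i _ => ho i⟩
    have : (⋃ i ∈ ⋃ m, R m, v i)ᶜ = ⋃ i ∈ (⋃ m, R m)ᶜ, v i := by
      ext x
      constructor
      · intro hx
        obtain ⟨i, hi⟩ := mem_iUnion.1 (hcov ▸ mem_univ x)
        exact mem_iUnion₂.2 ⟨i, fun hiR => hx (mem_iUnion₂.2 ⟨i, hiR, hi⟩), hi⟩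
      · intro hx hx'
        obtain ⟨i, hi, hxi⟩ := mem_iUnion₂.1 hx
        obtain ⟨j, hj, hxj⟩ := mem_iUnion₂.1 hx'
        exact hi (hstep j hj i ⟨x, hxi, hxj⟩)
    rw [this]
    exact isOpen_biUnion fun i _ => ho i
  have huniv := hclopen.eq_univ ⟨x₀, mem_iUnion₂.2 ⟨i₀, mem_iUnion.2 ⟨0, rfl⟩, hi₀⟩⟩
  refine countable_univ_iff.1 ((countable_iUnion fun m => (hRfin m).countable).mono ?_)
  intro i _
  obtain ⟨x, hx⟩ := hne i
  obtain ⟨j, hj, hxj⟩ := mem_iUnion₂.1 (huniv ▸ mem_univ x)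
  exact hstep j hj i ⟨x, hx, hxj⟩

theorem exists_countable_locallyFinite_compact_cover {M : Type u} [TopologicalSpace M] [T2Space M]
    [ParacompactSpace M] [ConnectedSpace M] [LocallyCompactSpace M] (U : M → Set M)
    (hU : ∀ a, U a ∈ 𝓝 a) :
    ∃ (ι : Type u) (_ : Countable ι) (a : ι → M) (A : ι → Set M), (∀ i, IsCompact (A i)) ∧
      (∀ i, (A i).Nonempty) ∧ LocallyFinite A ∧ (∀ x, ∃ i, x ∈ interior (A i)) ∧
      ∀ i, A i ⊆ U (a i) := by
  choose K hK hKU hKc using fun a => local_compact_nhds (hU a)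
  obtain ⟨v, hvo, hvc, hvf, hvK⟩ := precise_refinement (fun a => interior (K a))
    (fun _ => isOpen_interior) (eq_univ_of_forall fun a =>
      mem_iUnion.2 ⟨a, mem_interior_iff_mem_nhds.2 (hK a)⟩)
  have hsub : ∀ a, closure (v a) ⊆ K a := fun a =>
    closure_minimal ((hvK a).trans interior_subset) (hKc a).isClosed
  have hcpt : ∀ a, IsCompact (closure (v a)) := fun a =>
    (hKc a).of_isClosed_subset isClosed_closure (hsub a)
  have hlf : LocallyFinite fun i : {a // (v a).Nonempty} => closure (v i) :=
    hvf.closure.comp_injective Subtype.val_injective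
  have hcov : ∀ x, ∃ i : {a // (v a).Nonempty}, x ∈ v i := fun x => by
    obtain ⟨a, ha⟩ := mem_iUnion.1 (hvc ▸ mem_univ x)
    exact ⟨⟨a, x, ha⟩, ha⟩
  refine ⟨{a // (v a).Nonempty}, ?_, fun i => i, fun i => closure (v i), fun i => hcpt i,
    fun i => i.2.closure, hlf, fun x => ?_, fun i => (hsub i).trans (hKU i)⟩
  · refine countable_of_finite_inter (v := fun i : {a // (v a).Nonempty} => v i)
      (fun i => hvo i) (fun i => i.2) (eq_univ_of_forall fun x => mem_iUnion.2 (hcov x)) fun i => ?_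
    refine (hlf.finite_nonempty_inter_compact (hcpt i)).subset fun j hj => ?_
    exact Set.Nonempty.mono (inter_subset_inter subset_closure subset_closure) hj
  · obtain ⟨i, hi⟩ := hcov x
    exact ⟨i, interior_maximal subset_closure (hvo i) hi⟩

/-! ### `E`-pairs at a point and their invariance under biholomorphic maps -/

section RestrictScalars

variable {E F X Y : Type*} [NormedAddCommGroup E] [NormedSpace ℂ E] [NormedAddCommGroup F]
  [NormedSpace ℂ F] [NormedSpace ℝ E] [IsScalarTower ℝ ℂ E] [NormedSpace ℝ F]
  [IsScalarTower ℝ ℂ F] [TopologicalSpace X] [ChartedSpace E X] [TopologicalSpace Y]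
  [ChartedSpace F Y] {f : X → Y} {x : X}

theorem ContMDiffAt.real_of_complex {m : WithTop ℕ∞}
    (h : ContMDiffAt 𝓘(ℂ, E) 𝓘(ℂ, F) m f x) : ContMDiffAt 𝓘(ℝ, E) 𝓘(ℝ, F) m f x := by
  rw [contMDiffAt_iff] at h ⊢
  refine ⟨h.1, ?_⟩
  have := h.2.restrict_scalars ℝ
  simpa only [modelWithCornersSelf_coe, range_id] using! this

theorem HasMFDerivAt.real_of_complex {f' : E →L[ℂ] F}
    (h : HasMFDerivAt 𝓘(ℂ, E) 𝓘(ℂ, F) f x f') :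
    HasMFDerivAt 𝓘(ℝ, E) 𝓘(ℝ, F) f x (f'.restrictScalars ℝ) := by
  refine ⟨h.1, ?_⟩
  have := HasFDerivWithinAt.restrictScalars ℝ h.2
  simpa only [modelWithCornersSelf_coe, range_id] using! this

end RestrictScalars

namespace CRStructure

variable {n k : ℕ} {M : Type u} [TopologicalSpace M]
  [ChartedSpace (EuclideanSpace ℝ (Fin (2 * n + k))) M] [IsManifold (𝓡 (2 * n + k)) ∞ M]

/-- The conditions on the differential at `a` of a generic `CR` embedding. -/
structure IsCRDifferential (S : CRStructure n k M) (a : M)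
    (T : TangentSpace (𝓡 (2 * n + k)) a →L[ℝ] EuclideanSpace ℂ (Fin (n + k))) : Prop where
  injective : Function.Injective T
  map_J : ∀ v : S.H a, T (S.J a v).1 = Complex.I • T v.1
  map_H : (S.H a).map T.toLinearMap = LinearMap.range T.toLinearMap ⊓
    (LinearMap.range T.toLinearMap).map ((LinearMap.lsmul ℂ (EuclideanSpace ℂ (Fin (n + k)))
      Complex.I).restrictScalars ℝ)

theorem IsCRDifferential.comp {S : CRStructure n k M} {a : M}
    {T : TangentSpace (𝓡 (2 * n + k)) a →L[ℝ] EuclideanSpace ℂ (Fin (n + k))}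
    (hT : S.IsCRDifferential a T)
    {B : EuclideanSpace ℂ (Fin (n + k)) →L[ℂ] EuclideanSpace ℂ (Fin (n + k))}
    (hB : Function.Injective B) : S.IsCRDifferential a ((B.restrictScalars ℝ).comp T) where
  injective := hB.comp hT.injective
  map_J v := by
    change B (T _) = _ • B (T _)
    rw [hT.map_J, map_smul]
  map_H := by
    have hcomp : ((B.restrictScalars ℝ).comp T).toLinearMap =
      (B.restrictScalars ℝ).toLinearMap.comp T.toLinearMap := rfl
    have hcomm : ((LinearMap.lsmul ℂ (EuclideanSpace ℂ (Fin (n + k)))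
          Complex.I).restrictScalars ℝ).comp (B.restrictScalars ℝ).toLinearMap =
        (B.restrictScalars ℝ).toLinearMap.comp ((LinearMap.lsmul ℂ
          (EuclideanSpace ℂ (Fin (n + k))) Complex.I).restrictScalars ℝ) := by
      ext v : 1
      exact (B.map_smul Complex.I v).symm
    rw [hcomp, Submodule.map_comp, hT.map_H, LinearMap.range_comp,
      Submodule.map_inf _ (show Function.Injective (B.restrictScalars ℝ).toLinearMap from hB),
      ← Submodule.map_comp, ← Submodule.map_comp, hcomm]

variable {X : Type*} [TopologicalSpace X] [ChartedSpace (EuclideanSpace ℂ (Fin (n + k))) X]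

/-- The conditions in the definition of an `E`-pair which concern the germ of `φ` at `a`, that is,
all except the embedding property. -/
structure IsEPairAt (S : CRStructure n k M) (φ : M → X) (a : M) : Prop where
  contMDiffAt : ContMDiffAt (𝓡 (2 * n + k)) 𝓘(ℝ, EuclideanSpace ℂ (Fin (n + k))) ∞ φ a
  isCRDifferential : S.IsCRDifferential a
    (mfderiv (𝓡 (2 * n + k)) 𝓘(ℝ, EuclideanSpace ℂ (Fin (n + k))) φ a)
  comp_mem : ∀ f : X → ℂ,
    (∀ᶠ p in 𝓝 (φ a), MDifferentiableAt 𝓘(ℂ, EuclideanSpace ℂ (Fin (n + k))) 𝓘(ℂ, ℂ) f p) →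
    ((f ∘ φ : M → ℂ) : Germ (𝓝 a) ℂ) ∈ S.crGerms a
  exists_extension : ∀ u : M → ℂ, (u : Germ (𝓝 a) ℂ) ∈ S.crGerms a → ∃ f : X → ℂ,
    (∀ᶠ p in 𝓝 (φ a), MDifferentiableAt 𝓘(ℂ, EuclideanSpace ℂ (Fin (n + k))) 𝓘(ℂ, ℂ) f p) ∧
    f ∘ φ =ᶠ[𝓝 a] u
  extension_unique : ∀ f g : X → ℂ,
    (∀ᶠ p in 𝓝 (φ a), MDifferentiableAt 𝓘(ℂ, EuclideanSpace ℂ (Fin (n + k))) 𝓘(ℂ, ℂ) f p) →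
    (∀ᶠ p in 𝓝 (φ a), MDifferentiableAt 𝓘(ℂ, EuclideanSpace ℂ (Fin (n + k))) 𝓘(ℂ, ℂ) g p) →
    f ∘ φ =ᶠ[𝓝 a] g ∘ φ → f =ᶠ[𝓝 (φ a)] g

theorem coe_mem_holGerms_iff {N : ℕ} {X : Type*} [TopologicalSpace X]
    [ChartedSpace (EuclideanSpace ℂ (Fin N)) X] {p : X} {f : X → ℂ} :
    (f : Germ (𝓝 p) ℂ) ∈ holGerms (N := N) p ↔
      ∀ᶠ q in 𝓝 p, MDifferentiableAt 𝓘(ℂ, EuclideanSpace ℂ (Fin N)) 𝓘(ℂ, ℂ) f q := by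
  constructor
  · rintro ⟨W, hW, hp, g, hg, hfg⟩
    filter_upwards [(Germ.coe_eq.1 hfg).eventually_nhds, hW.mem_nhds hp] with q hq hqW
    exact (hg.mdifferentiableAt (hW.mem_nhds hqW)).congr_of_eventuallyEq hq
  · intro h
    obtain ⟨W, hWf, hW, hp⟩ := eventually_nhds_iff.1 h
    exact ⟨W, hW, hp, f, fun q hq => (hWf q hq).mdifferentiableWithinAt, rfl⟩

/-- For `φ` continuous at `a`, the last three conditions of `IsEPairAt` say that restriction of
germs along `φ` is a bijection. -/
theorem bijOn_compTendsto_iff (S : CRStructure n k M) {φ : M → X} {a : M}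
    (h : Tendsto φ (𝓝 a) (𝓝 (φ a))) :
    BijOn (fun g : Germ (𝓝 (φ a)) ℂ => g.compTendsto φ h)
      (holGerms (N := n + k) (φ a)) (S.crGerms a) ↔
    (∀ f : X → ℂ,
      (∀ᶠ p in 𝓝 (φ a), MDifferentiableAt 𝓘(ℂ, EuclideanSpace ℂ (Fin (n + k))) 𝓘(ℂ, ℂ) f p) →
      ((f ∘ φ : M → ℂ) : Germ (𝓝 a) ℂ) ∈ S.crGerms a) ∧
    (∀ u : M → ℂ, (u : Germ (𝓝 a) ℂ) ∈ S.crGerms a → ∃ f : X → ℂ,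
      (∀ᶠ p in 𝓝 (φ a), MDifferentiableAt 𝓘(ℂ, EuclideanSpace ℂ (Fin (n + k))) 𝓘(ℂ, ℂ) f p) ∧
      f ∘ φ =ᶠ[𝓝 a] u) ∧
    ∀ f g : X → ℂ,
      (∀ᶠ p in 𝓝 (φ a), MDifferentiableAt 𝓘(ℂ, EuclideanSpace ℂ (Fin (n + k))) 𝓘(ℂ, ℂ) f p) →
      (∀ᶠ p in 𝓝 (φ a), MDifferentiableAt 𝓘(ℂ, EuclideanSpace ℂ (Fin (n + k))) 𝓘(ℂ, ℂ) g p) →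
      f ∘ φ =ᶠ[𝓝 a] g ∘ φ → f =ᶠ[𝓝 (φ a)] g := by
  constructor
  · rintro ⟨hmaps, hinj, hsurj⟩
    refine ⟨fun f hf => hmaps (coe_mem_holGerms_iff.2 hf), fun u hu => ?_, fun f g hf hg hfg => ?_⟩
    · obtain ⟨g, hg, hgu⟩ := hsurj hu
      induction g using Germ.inductionOn with
      | _ f => exact ⟨f, coe_mem_holGerms_iff.1 hg, Germ.coe_eq.1 hgu⟩
    · exact Germ.coe_eq.1 (hinj (coe_mem_holGerms_iff.2 hf) (coe_mem_holGerms_iff.2 hg)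
        (Germ.coe_eq.2 hfg))
  · rintro ⟨hmaps, hsurj, hinj⟩
    refine ⟨fun g hg => ?_, fun g hg g' hg' h' => ?_, fun g hg => ?_⟩
    · induction g using Germ.inductionOn with
      | _ f => exact hmaps f (coe_mem_holGerms_iff.1 hg)
    · induction g using Germ.inductionOn with
      | _ f =>
        induction g' using Germ.inductionOn with
        | _ f' => exact Germ.coe_eq.2 (hinj f f' (coe_mem_holGerms_iff.1 hg)
            (coe_mem_holGerms_iff.1 hg') (Germ.coe_eq.1 h'))
    · induction g using Germ.inductionOn with
      | _ u =>
        obtain ⟨f, hf, hfu⟩ := hsurj u hg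
        exact ⟨f, coe_mem_holGerms_iff.2 hf, Germ.coe_eq.2 hfu⟩

theorem isEPairOn_iff {S : CRStructure n k M} {U : Opens M} {X : Type u} [TopologicalSpace X]
    [ChartedSpace (EuclideanSpace ℂ (Fin (n + k))) X] {φ : M → X} :
    S.IsEPairOn U φ ↔ Topology.IsEmbedding ((U : Set M).domRestrict φ) ∧
      ∀ a ∈ U, S.IsEPairAt φ a := by
  constructor
  · rintro ⟨h, hg⟩
    refine ⟨h.isEmbedding, fun a ha => ?_⟩
    obtain ⟨h1, h2, h3⟩ := (S.bijOn_compTendsto_iff (h.tendsto ha)).1 (hg a ha)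
    exact ⟨h.smooth.contMDiffAt (U.isOpen.mem_nhds ha),
      ⟨h.immersion a ha, h.isCR a ha, h.map_H a ha⟩, h1, h2, h3⟩
  · rintro ⟨he, h⟩
    have h' : S.IsGenericCREmbeddingOn U φ :=
      { smooth := fun a ha => (h a ha).contMDiffAt.contMDiffWithinAt
        isEmbedding := he
        immersion := fun a ha => (h a ha).isCRDifferential.injective
        isCR := fun a ha => (h a ha).isCRDifferential.map_J
        map_H := fun a ha => (h a ha).isCRDifferential.map_H }
    exact ⟨h', fun a ha => (S.bijOn_compTendsto_iff (h'.tendsto ha)).2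
      ⟨(h a ha).comp_mem, (h a ha).exists_extension, (h a ha).extension_unique⟩⟩

namespace IsEPairAt

variable {S : CRStructure n k M} {φ : M → X} {a : M}

theorem congr_of_eventuallyEq (h : S.IsEPairAt φ a) {φ' : M → X} (hφ : φ' =ᶠ[𝓝 a] φ) :
    S.IsEPairAt φ' a := by
  have hcomp : ∀ f : X → ℂ, f ∘ φ' =ᶠ[𝓝 a] f ∘ φ := fun f => hφ.fun_comp f
  have ha := hφ.eq_of_nhds
  constructor
  · exact h.contMDiffAt.congr_of_eventuallyEq hφ
  · have := h.isCRDifferential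
    rwa [← hφ.mfderiv_eq] at this
  · intro f hf
    rw [Germ.coe_eq.2 (hcomp f)]
    exact h.comp_mem f (ha ▸ hf)
  · intro u hu
    obtain ⟨f, hf, hfu⟩ := h.exists_extension u hu
    exact ⟨f, ha ▸ hf, (hcomp f).trans hfu⟩
  · intro f g hf hg hfg
    rw [ha] at hf hg ⊢
    exact h.extension_unique f g hf hg ((hcomp f).symm.trans (hfg.trans (hcomp g)))

/-- The conditions of an `E`-pair at a point are invariant under local biholomorphisms. -/
theorem openPartialHomeomorph_comp {Y : Type*} [TopologicalSpace Y]
    [ChartedSpace (EuclideanSpace ℂ (Fin (n + k))) Y] (h : S.IsEPairAt φ a)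
    {ψ : OpenPartialHomeomorph X Y} (ha : φ a ∈ ψ.source)
    (hψ : ContMDiffOn 𝓘(ℂ, EuclideanSpace ℂ (Fin (n + k))) 𝓘(ℂ, EuclideanSpace ℂ (Fin (n + k)))
      ω ψ ψ.source)
    (hψ' : ContMDiffOn 𝓘(ℂ, EuclideanSpace ℂ (Fin (n + k))) 𝓘(ℂ, EuclideanSpace ℂ (Fin (n + k)))
      ω ψ.symm ψ.target) : S.IsEPairAt (ψ ∘ φ) a := by
  have hcont : Tendsto φ (𝓝 a) (𝓝 (φ a)) := h.contMDiffAt.continuousAt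
  have hsrc : ∀ᶠ x in 𝓝 a, φ x ∈ ψ.source := hcont.eventually (ψ.open_source.mem_nhds ha)
  have hψa := hψ.contMDiffAt (ψ.open_source.mem_nhds ha)
  have hsymm : Tendsto ψ.symm (𝓝 (ψ (φ a))) (𝓝 (φ a)) := by
    simpa [ContinuousAt, ψ.left_inv ha] using ψ.symm.continuousAt (ψ.map_source ha)
  have hmd : ψ.MDifferentiable 𝓘(ℂ, EuclideanSpace ℂ (Fin (n + k)))
      𝓘(ℂ, EuclideanSpace ℂ (Fin (n + k))) :=
    ⟨hψ.mdifferentiableOn (by simp), hψ'.mdifferentiableOn (by simp)⟩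
  have hpush : ∀ f : Y → ℂ, (∀ᶠ p in 𝓝 (ψ (φ a)),
      MDifferentiableAt 𝓘(ℂ, EuclideanSpace ℂ (Fin (n + k))) 𝓘(ℂ, ℂ) f p) →
      ∀ᶠ p in 𝓝 (φ a),
        MDifferentiableAt 𝓘(ℂ, EuclideanSpace ℂ (Fin (n + k))) 𝓘(ℂ, ℂ) (f ∘ ψ) p := by
    intro f hf
    filter_upwards [(ψ.continuousAt ha).eventually hf, ψ.open_source.mem_nhds ha] with p hp hps
    exact hp.comp p (hmd.mdifferentiableAt hps)
  have hback : ∀ f : X → ℂ, f ∘ φ =ᶠ[𝓝 a] (f ∘ ψ.symm) ∘ (ψ ∘ φ) := by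
    intro f
    filter_upwards [hsrc] with x hx
    simp [ψ.left_inv hx]
  constructor
  · exact ContMDiffAt.comp a ((hψa.of_le le_top).real_of_complex) h.contMDiffAt
  · have h1 := (hmd.mdifferentiableAt ha).hasMFDerivAt.real_of_complex
    have h2 := (h.contMDiffAt.mdifferentiableAt (by simp)).hasMFDerivAt
    have h3 := (h1.comp a h2).mfderiv
    have h4 := h.isCRDifferential.comp (hmd.mfderiv_injective ha)
    exact (congrArg (fun T : TangentSpace (𝓡 (2 * n + k)) a →L[ℝ]
      EuclideanSpace ℂ (Fin (n + k)) => S.IsCRDifferential a T) h3).mpr h4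
  · intro f hf
    exact h.comp_mem (f ∘ ψ) (hpush f hf)
  · intro u hu
    obtain ⟨f, hf, hfu⟩ := h.exists_extension u hu
    refine ⟨f ∘ ψ.symm, ?_, (hback f).symm.trans hfu⟩
    filter_upwards [hsymm.eventually hf, ψ.open_target.mem_nhds (ψ.map_source ha)] with p hp hpt
    exact hp.comp p (hmd.mdifferentiableAt_symm hpt)
  · intro f g hf hg hfg
    have := h.extension_unique (f ∘ ψ) (g ∘ ψ) (hpush f hf) (hpush g hg) hfg
    filter_upwards [hsymm.eventually this, ψ.open_target.mem_nhds (ψ.map_source ha)] with p hp hpt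
    simpa [ψ.right_inv hpt] using hp

end IsEPairAt

end CRStructure

/-! ### Gluing `E`-pairs -/

namespace CRStructure

variable {n k : ℕ} {M : Type u} [TopologicalSpace M]
  [ChartedSpace (EuclideanSpace ℝ (Fin (2 * n + k))) M] [IsManifold (𝓡 (2 * n + k)) ∞ M]

/-- An open set with property `E` is locally part of an `E`-pair with target `ℂ ^ (n + k)`. -/
theorem HasPropertyEOn.exists_isEPairAt {S : CRStructure n k M} {U : Opens M}
    (h : S.HasPropertyEOn U) {a : M} (ha : a ∈ U) :
    ∃ (V : Set M) (φ : M → EuclideanSpace ℂ (Fin (n + k))), IsOpen V ∧ a ∈ V ∧ InjOn φ V ∧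
      ∀ x ∈ V, S.IsEPairAt φ x := by
  obtain ⟨X, _, _, _, _, _, _, φ, hφ⟩ := h
  obtain ⟨hemb, hpt⟩ := isEPairOn_iff.1 hφ
  let e := chartAt (EuclideanSpace ℂ (Fin (n + k))) (φ a)
  have he : e ∈ IsManifold.maximalAtlas 𝓘(ℂ, EuclideanSpace ℂ (Fin (n + k))) ω X :=
    IsManifold.chart_mem_maximalAtlas _
  have hcont : ContinuousOn φ U := fun x hx =>
    (hpt x hx).contMDiffAt.continuousAt.continuousWithinAt
  refine ⟨U ∩ φ ⁻¹' e.source, e ∘ φ, hcont.isOpen_inter_preimage U.isOpen e.open_source,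
    ⟨ha, mem_chart_source _ _⟩, ?_, fun x hx => ?_⟩
  · have hinj : InjOn φ U := injOn_iff_injective.2 hemb.injective
    exact e.injOn.comp (hinj.mono inter_subset_left) fun x hx => hx.2
  · exact (hpt x hx.1).openPartialHomeomorph_comp hx.2 (contMDiffOn_of_mem_maximalAtlas he)
      (contMDiffOn_symm_of_mem_maximalAtlas he)

/-- The components of an `E`-pair `ψ` are `CR` functions, hence extend holomorphically along any
other `E`-pair `φ`. -/
theorem IsEPairAt.exists_isTransitionAt {S : CRStructure n k M}
    {φ ψ : M → EuclideanSpace ℂ (Fin (n + k))} {a : M} (hφ : S.IsEPairAt φ a)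
    (hψ : S.IsEPairAt ψ a) :
    ∃ F : EuclideanSpace ℂ (Fin (n + k)) → EuclideanSpace ℂ (Fin (n + k)),
      IsTransitionAt φ ψ a F := by
  have hcoord : ∀ l, ∃ f : EuclideanSpace ℂ (Fin (n + k)) → ℂ,
      (∀ᶠ p in 𝓝 (φ a), DifferentiableAt ℂ f p) ∧ ∀ᶠ x in 𝓝 a, f (φ x) = ψ x l := by
    intro l
    obtain ⟨f, hf, hfψ⟩ := hφ.exists_extension _ (hψ.comp_mem (fun p => p l)
      (Eventually.of_forall fun p => mdifferentiableAt_iff_differentiableAt.2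
        (EuclideanSpace.proj (𝕜 := ℂ) l).differentiableAt))
    exact ⟨f, hf.mono fun p hp => mdifferentiableAt_iff_differentiableAt.1 hp, hfψ⟩
  choose f hf hfψ using hcoord
  refine ⟨fun p => WithLp.toLp 2 fun l => f l p,
    analyticAt_euclidean_of_eventually_differentiableAt ?_, ?_⟩
  · filter_upwards [eventually_all.2 hf] with p hp
    exact differentiableAt_euclidean.2 hp
  · filter_upwards [eventually_all.2 hfψ] with x hx
    ext l
    exact hx l

theorem IsEPairAt.eventuallyEq_of_analyticAt {S : CRStructure n k M}
    {φ : M → EuclideanSpace ℂ (Fin (n + k))} {a : M} (hφ : S.IsEPairAt φ a)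
    {F G : EuclideanSpace ℂ (Fin (n + k)) → EuclideanSpace ℂ (Fin (n + k))}
    (hF : AnalyticAt ℂ F (φ a)) (hG : AnalyticAt ℂ G (φ a))
    (h : ∀ᶠ x in 𝓝 a, F (φ x) = G (φ x)) : F =ᶠ[𝓝 (φ a)] G := by
  have hmd : ∀ {F : EuclideanSpace ℂ (Fin (n + k)) → EuclideanSpace ℂ (Fin (n + k))},
      AnalyticAt ℂ F (φ a) → ∀ l, ∀ᶠ p in 𝓝 (φ a),
        MDifferentiableAt 𝓘(ℂ, EuclideanSpace ℂ (Fin (n + k))) 𝓘(ℂ, ℂ) (fun p => F p l) p := by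
    intro F hF l
    filter_upwards [hF.eventually_analyticAt] with p hp
    exact mdifferentiableAt_iff_differentiableAt.2
      (differentiableAt_euclidean.1 hp.differentiableAt l)
  have hl : ∀ l, ∀ᶠ p in 𝓝 (φ a), F p l = G p l := fun l =>
    hφ.extension_unique _ _ (hmd hF l) (hmd hG l) (by
      filter_upwards [h] with x hx
      simp [hx])
  filter_upwards [eventually_all.2 hl] with p hp
  ext l
  exact hp l

end CRStructure

theorem theorem1p4 {n k : ℕ} {M : Type u} [TopologicalSpace M] [T2Space M] [ParacompactSpace M]
    [ConnectedSpace M] [ChartedSpace (EuclideanSpace ℝ (Fin (2 * n + k))) M]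
    [IsManifold (𝓡 (2 * n + k)) ∞ M] (S : CRStructure n k M) :
    S.HasPropertyE ↔ ∀ a : M, ∃ U : TopologicalSpace.Opens M, a ∈ U ∧ S.HasPropertyEOn U := by
  refine ⟨fun h a => ⟨⊤, trivial, h⟩, fun h => ?_⟩
  have hloc : ∀ a : M, ∃ (V : Set M) (φ : M → EuclideanSpace ℂ (Fin (n + k))), IsOpen V ∧ a ∈ V ∧
      InjOn φ V ∧ ∀ x ∈ V, S.IsEPairAt φ x := fun a => by
    obtain ⟨U, ha, hU⟩ := h a
    exact hU.exists_isEPairAt ha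
  choose V φ hV haV hinj hpair using hloc
  have : LocallyCompactSpace M :=
    ChartedSpace.locallyCompactSpace (EuclideanSpace ℝ (Fin (2 * n + k))) M
  obtain ⟨ι, _, c, A, hA, hAne, hAfin, hAcov, hAV⟩ :=
    exists_countable_locallyFinite_compact_cover V fun a => (hV a).mem_nhds (haV a)
  let D : AnalyticThickening ι M (EuclideanSpace ℂ (Fin (n + k))) :=
    { A := A
      U := fun i => V (c i)
      φ := fun i => φ (c i)
      isCompact_A := hA
      nonempty_A := hAne
      locallyFinite_A := hAfin
      exists_mem_interior_A := hAcov
      isOpen_U := fun i => hV (c i)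
      A_subset_U := hAV
      continuousOn_φ := fun i x hx =>
        (hpair (c i) x hx).contMDiffAt.continuousAt.continuousWithinAt
      injOn_φ := fun i => hinj (c i)
      exists_isTransitionAt := fun {i j x} hi hj =>
        (hpair (c i) x hi).exists_isTransitionAt (hpair (c j) x hj)
      eventuallyEq := fun {i x _ _} hx hF hG hFG =>
        (hpair (c i) x hx).eventuallyEq_of_analyticAt hF hG hFG }
  refine ⟨D.Thickened, inferInstance, inferInstance, inferInstance, inferInstance, inferInstance,
    inferInstance, D.toThickened, CRStructure.isEPairOn_iff.2
      ⟨D.isClosedEmbedding_toThickened.isEmbedding.comp .subtypeVal, fun a _ => ?_⟩⟩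
  obtain ⟨i, hi⟩ := D.exists_mem_interior_A a
  have hchart := AnalyticGluing.chart_mem_maximalAtlas (G := D.gluing) i
  have hsymm : S.IsEPairAt ((D.gluing.chart i).symm ∘ D.φ i) a := by
    refine (hpair (c i) a (hAV i (interior_subset hi))).openPartialHomeomorph_comp ?_
      (contMDiffOn_symm_of_mem_maximalAtlas hchart) (contMDiffOn_of_mem_maximalAtlas hchart)
    rw [OpenPartialHomeomorph.symm_source, AnalyticGluing.chart_target]
    exact D.mem_piece (interior_subset hi)
  refine hsymm.congr_of_eventuallyEq ?_
  filter_upwards [mem_interior_iff_mem_nhds.1 hi] with x hx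
  rw [Function.comp_apply, ← D.chart_toThickened hx,
    (D.gluing.chart i).left_inv (D.toThickened_mem_chart_source hx)]
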